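/- Fix an origin–destination pair $(i,j)$ of a food-delivery platform. Orders (``seekers'') of this pair arrive as a Poisson process of rate $\lambda=\lambda_{ij}^{g,all}>0$, starting at time $0$ with no courier dispatched. A seeker that is dispatched to an idle courier (one is always at hand) turns this courier into a taker in state $t^1_{(i,j,1)}$. In general a courier is a taker in state $t^m_{(i,j,n)}$, $(n,m)\in\{(1,1),(2,1),(2,2)\}$, while $n$ orders have been dispatched to her and she is en route to pick up the $m$-th of them. The time she needs to pick up her first order is exponential with mean $w=w_i^c>0$; the time she needs, after that, to pick up a second order dispatched to her before the first pickup is exponential with mean $t=t_i^c>0$; all interarrival and pickup times are independent. A taker to whom a seeker is matched moves from $t^1_{(i,j,1)}$ to $t^1_{(i,j,2)}$, or from $t^m_{(i,j,2)}$ ($m=1,2$) to having three orders, which is her capacity, so that she is no longer a taker. A courier who has picked up all orders dispatched to her starts the delivery and is no longer a taker. Assume that a seeker is matched to a taker whenever one is available and is dispatched to an idle courier only if there is no taker, and that distinct orders do not arrive simultaneously. Then at every time there is at most one taker of the pair $(i,j)$; in particular there is at most one taker in each state $t^m_{(i,j,n)}$. (This holds for every realization of the arrival and pickup times, whatever their distribution.)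 Moreover, the following long-run quantities exist: * $p=p_{s_{(i,j)}}$, the probability that a seeker is matched to a taker: the almost sure limit as $N\to\infty$ of the fraction of the first $N$ seekers that are matched to a taker, and also the limit of the average over the first $N$ seekers of the probability of being matched to a taker; * for each state $x=t^m_{(i,j,n)}$, the probability $\rho_x$ that a taker in state $x$ exists: the almost sure limit as $T\to\infty$ of the fraction of $[0,T]$ during which a taker in state $x$ exists, and also the limit of $\frac1T\int_0^T P(\text{a taker in state } x \text{ exists at time } r)\,dr$; * for each state $x$, the arrival rate $\lambda_x^{um}$ of takers in state $x$: the almost sure limit as $T\to\infty$ of the number of takers that have entered state $x$ by time $T$, divided by $T$; * for each state $x$, the expected time $\tau_x$ that a taker spends in state $x$: the almost sure limit as $T\to\infty$ of the average time spent in $x$ by the takers that have entered $x$ by time $T$. They satisfy $p=\rho_{t^1_{(i,j,1)}}+\rho_{t^1_{(i,j,2)}}+\rho_{t^2_{(i,j,2)}}$ and $$\rho_{t^1_{(i,j,1)}}=\lambda^{um}_{t^1_{(i,j,1)}}\tau_{t^1_{(i,j,1)}}=\lambda(1-p)\,\frac{w}{1+\lambda w},$$ $$\rho_{t^1_{(i,j,2)}}=\lambda^{um}_{t^1_{(i,j,2)}}\tau_{t^1_{(i,j,2)}}=\lambda(1-p)\,\frac{\lambda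 w}{1+\lambda w}\,\frac{w}{1+\lambda w},$$ $$\rho_{t^2_{(i,j,2)}}=\lambda^{um}_{t^2_{(i,j,2)}}\tau_{t^2_{(i,j,2)}}=\lambda(1-p)\,\frac{\lambda w}{(1+\lambda w)^2}\,\frac{t}{1+\lambda t}.$$ -/

import Mathlib

open MeasureTheory ProbabilityTheory Filter Topology

/-- The three taker states of a fixed origin-destination pair. `one_one`: one order dispatched,
en route to the first order; `two_one`: two orders dispatched, en route to the first order;
`two_two`: two orders dispatched, en route to the second order. -/
inductive TakerState where
  | one_one
  | two_one
  | two_two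

/-- One realization of the order stream of a fixed origin-destination pair, together with the
decisions of the platform. Orders (seekers) are numbered `0, 1, 2, …` in order of arrival.

If order `c` is dispatched to an idle courier, that courier is called courier `c`; then
`firstPickup c` is the time she needs to reach and pick up her first order (order `c`) and
`secondPickup c` the time she needs to pick up her second order, if there is one, counted from
the first pickup.

`partner k = some c` means that order `k` is matched to the taker `c`, and `partner k = none` that
order `k` is dispatched to an idle courier. -/
structure Realization where
  interarrival : ℕ → ℝ
  firstPickup : ℕ → ℝ
  secondPickup : ℕ → ℝ
  partner : ℕ → Option ℕ

namespace Realization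

variable (R : Realization)

/-- The arrival time of order `k`; the clock starts at time `0` with no taker in the system. -/
def arrival (k : ℕ) : ℝ := ∑ l ∈ Finset.range (k + 1), R.interarrival l

/-- Number of orders, among the orders in `seen`, that have been dispatched to courier `c`. -/
noncomputable def load (seen : Set ℕ) (c : ℕ) : ℕ :=
  Set.ncard {k ∈ seen | k = c ∨ R.partner k = some c}

/-- Courier `c` has been dispatched, and at time `u` she is a taker in state `s`, if the orders
that have arrived so far are those in `seen`. A courier who has picked up all the orders dispatched
to her has begun the delivery and is no taker; neither is a courier with three orders. -/
def InStateGiven (seen : Set ℕ) (c : ℕ) (u : ℝ) (s : TakerState) : Prop :=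
  c ∈ seen ∧ R.partner c = none ∧
    match s with
    | .one_one => R.load seen c = 1 ∧ u < R.arrival c + R.firstPickup c
    | .two_one => R.load seen c = 2 ∧ u < R.arrival c + R.firstPickup c
    | .two_two => R.load seen c = 2 ∧ R.arrival c + R.firstPickup c ≤ u ∧
        u < R.arrival c + R.firstPickup c + R.secondPickup c

/-- At time `u`, courier `c` is a taker in state `s`. -/
def InState (c : ℕ) (u : ℝ) (s : TakerState) : Prop :=
  R.InStateGiven {l | R.arrival l ≤ u} c u s

/-- When order `k` arrives, courier `c` is a taker, available to be matched to it. Only the orders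
that arrived strictly before order `k` have been assigned at that moment. -/
def AvailableFor (c k : ℕ) : Prop :=
  ∃ s, R.InStateGiven {l | R.arrival l < R.arrival k} c (R.arrival k) s

/-- The matching rule: a seeker is matched to an available taker whenever there is one, and
is dispatched to an idle courier only if there is none. -/
def TakersFirst : Prop :=
  (∀ k c, R.partner k = some c → R.AvailableFor c k) ∧
    ∀ k, R.partner k = none → ∀ c, ¬ R.AvailableFor c k

/-- Distinct orders do not arrive simultaneously (orders being numbered by arrival). -/
def NoSimultaneousArrivals : Prop := StrictMono R.arrival

/-- At time `u` there is a taker in state `s`. -/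
def TakerExists (s : TakerState) (u : ℝ) : Prop := ∃ c, R.InState c u s

/-- The takers that have entered state `s` by time `u`. (A taker enters a state at most once.) -/
def entered (s : TakerState) (u : ℝ) : Set ℕ := {c | ∃ r ≤ u, R.InState c r s}

/-- The total time that courier `c` spends as a taker in state `s`. -/
noncomputable def dwellTime (s : TakerState) (c : ℕ) : ℝ :=
  volume.real {r | R.InState c r s}

/-- Fraction of the time interval `[0, u]` during which there is a taker in state `s`. -/
noncomputable def existenceFraction (s : TakerState) (u : ℝ) : ℝ :=
  volume.real {r ∈ Set.Icc 0 u | R.TakerExists s r} / u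

/-- Number of takers entering state `s` per unit of time, up to time `u`. -/
noncomputable def entryRate (s : TakerState) (u : ℝ) : ℝ :=
  ((R.entered s u).ncard : ℝ) / u

/-- Average time spent in state `s` by the takers that have entered it by time `u`. -/
noncomputable def meanDwellTime (s : TakerState) (u : ℝ) : ℝ :=
  (∑ᶠ c ∈ R.entered s u, R.dwellTime s c) / (R.entered s u).ncard

/-- Fraction of the first `n` seekers that are matched to a taker. -/
noncomputable def matchedFraction (n : ℕ) : ℝ :=
  (Set.ncard {k | k < n ∧ R.partner k ≠ none} : ℝ) / n

end Realization

/-- The stochastic model of an origin-destination pair: seekers arrive as a Poisson process of rate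
`lam` (independent exponential interarrival times), the time to pick up the first order is
exponential with mean `w`, the time to pick up the second order is exponential with mean `t`, all
these times are independent, and takers have priority over idle couriers. -/
structure IsMatchingModel {Ω : Type*} [MeasurableSpace Ω] (μ : Measure Ω) (lam w t : ℝ)
    (X : Ω → Realization) : Prop where
  interarrival_law : ∀ k, HasLaw (fun ω => (X ω).interarrival k) (expMeasure lam) μ
  firstPickup_law : ∀ k, HasLaw (fun ω => (X ω).firstPickup k) (expMeasure (1 / w)) μ
  secondPickup_law : ∀ k, HasLaw (fun ω => (X ω).secondPickup k) (expMeasure (1 / t)) μ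
  independent : iIndepFun
    (Sum.elim (fun (k : ℕ) ω => (X ω).interarrival k)
      (Sum.elim (fun (k : ℕ) ω => (X ω).firstPickup k)
        (fun (k : ℕ) ω => (X ω).secondPickup k))) μ
  takersFirst : ∀ᵐ ω ∂μ, (X ω).TakersFirst

/-!
The process regenerates whenever a courier is dispatched: by the matching rule an idle courier is
called only when all earlier couriers are unavailable, and a courier who is once unavailable
remains so, since her number of orders no longer grows
(`not_inStateGiven_of_not_availableFor`). This gives uniqueness of the taker (`taker_unique`) and
cuts the orders into cycles. If `a` and `b` are the two interarrival times following the dispatch of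
a courier, and `f` and `p` are her pickup times, then the cycle consists of one order if `f ≤ a`, of
three orders if `a < f` and `a + b < f + p`, and of two orders otherwise (`cycle_cases`). The
periods that she spends in the three states are intervals with explicit end points
(`inState_iff`).

The beginning of a cycle is a stopping time for the sequence of orders, and the data
`(a, f, b, p)` of the cycle are independent of the past. If a cycle has only one order, then `b` is
an interarrival time of the next cycle as well, but nothing that is observed by the end of the cycle
depends on it. Hence each function of the cycle data that is known at the end of the cycle yields a
pairwise independent, identically distributed sequence along the cycles
(`measure_inter_cycle`, `indepFun_comp_cycle`), to which the strong law of large numbers applies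
(`tendsto_cycle_average`). By renewal-reward sandwich estimates the long-run quantities of a
realization are ratios of cycle means (`Realization.tendsto_of_cycle_averages`,
`Realization.tendsto_matchedFraction`). Convergence of the averaged probabilities follows by
dominated convergence and Fubini's theorem.

The cycle means are computed from the memorylessness of the exponential law
(`lintegral_lintegral_overshoot`) and from the mean of the minimum of two exponential variables
(`lintegral_stay`, `meanLength_eq`). The mean number of orders in a cycle turns out to be `1` plus
`lam` times the mean time with a taker, which is the identity between the matching probability and
the sum of the existence probabilities.
-/

/-! ### Uniqueness of the taker -/

namespace Realization

variable {R : Realization}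

/-- Courier `c` is a taker (in whichever state) if and only if she has one order and has not yet
picked it up, or has two orders and has not yet picked up both. -/
theorem exists_inStateGiven_iff {seen : Set ℕ} {c : ℕ} {u : ℝ} :
    (∃ s, R.InStateGiven seen c u s) ↔ c ∈ seen ∧ R.partner c = none ∧
      ((R.load seen c = 1 ∧ u < R.arrival c + R.firstPickup c) ∨
       (R.load seen c = 2 ∧ (u < R.arrival c + R.firstPickup c ∨
          u < R.arrival c + R.firstPickup c + R.secondPickup c))) := by
  constructor
  · rintro ⟨s, h1, h2, h3⟩
    refine ⟨h1, h2, ?_⟩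
    cases s <;> simp only at h3 <;> tauto
  · rintro ⟨h1, h2, h3 | ⟨h3, h4⟩⟩
    · exact ⟨.one_one, h1, h2, h3⟩
    · by_cases h : u < R.arrival c + R.firstPickup c
      · exact ⟨.two_one, h1, h2, h3, h⟩
      · exact ⟨.two_two, h1, h2, h3, not_lt.1 h, h4.resolve_left h⟩

theorem seen_eq_Iio (hA : R.NoSimultaneousArrivals) (k : ℕ) :
    {l | R.arrival l < R.arrival k} = Set.Iio k := by
  ext l; exact hA.lt_iff_lt

theorem lt_and_partner_eq_none (hA : R.NoSimultaneousArrivals) (hT : R.TakersFirst) {k c : ℕ}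
    (h : R.partner k = some c) : c < k ∧ R.partner c = none := by
  obtain ⟨s, h1, h2, -⟩ := hT.1 k c h
  exact ⟨hA.lt_iff_lt.1 h1, h2⟩

/-- A courier who is no taker when order `k` arrives is no taker later, as long as no further order
is dispatched to her. -/
theorem not_inStateGiven_of_not_availableFor (hA : R.NoSimultaneousArrivals) {c k : ℕ} (hck : c < k)
    (hav : ¬ R.AvailableFor c k) {seen : Set ℕ} (hs : Set.Iio k ⊆ seen)
    (hn : ∀ j ∈ seen, k ≤ j → R.partner j ≠ some c) {u : ℝ} (hu : R.arrival k ≤ u) :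
    ¬ ∃ s, R.InStateGiven seen c u s := by
  have hl : R.load seen c = R.load (Set.Iio k) c := by
    unfold load
    congr 1
    ext j
    simp only [Set.mem_ofPred_eq, Set.mem_Iio]
    constructor
    · rintro ⟨h1, h2⟩
      refine ⟨?_, h2⟩
      by_contra hj
      rcases h2 with rfl | h2
      · exact hj hck
      · exact hn j h1 (not_lt.1 hj) h2
    · rintro ⟨h1, h2⟩
      exact ⟨hs h1, h2⟩
  intro h
  apply hav
  unfold AvailableFor
  rw [exists_inStateGiven_iff] at h ⊢
  rw [seen_eq_Iio hA]
  rw [hl] at h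
  obtain ⟨-, h2, h3⟩ := h
  refine ⟨hck, h2, ?_⟩
  rcases h3 with ⟨h3, h4⟩ | ⟨h3, h4 | h4⟩
  · exact Or.inl ⟨h3, by linarith⟩
  · exact Or.inr ⟨h3, Or.inl (by linarith)⟩
  · exact Or.inr ⟨h3, Or.inr (by linarith)⟩

/-- A courier who is once passed over as unavailable is never matched again. -/
theorem partner_ne_of_not_availableFor (hA : R.NoSimultaneousArrivals) (hT : R.TakersFirst)
    {c k : ℕ} (hck : c < k) (hav : ¬ R.AvailableFor c k) :
    ∀ j, k ≤ j → R.partner j ≠ some c := by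
  intro j
  induction j using Nat.strong_induction_on with
  | _ j ih =>
    intro hkj hp
    have h := hT.1 j c hp
    unfold AvailableFor at h
    rw [seen_eq_Iio hA] at h
    exact not_inStateGiven_of_not_availableFor hA hck hav (Set.Iio_subset_Iio hkj)
      (fun i hi => ih i hi) (hA.monotone hkj) h

theorem not_inState_of_not_availableFor (hA : R.NoSimultaneousArrivals) (hT : R.TakersFirst)
    {c k : ℕ} (hck : c < k) (hav : ¬ R.AvailableFor c k) {u : ℝ} (hu : R.arrival k ≤ u)
    (s : TakerState) : ¬ R.InState c u s := fun h =>
  not_inStateGiven_of_not_availableFor hA hck hav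
    (fun _ hl => (hA.monotone (le_of_lt hl)).trans hu)
    (fun j _ hj => partner_ne_of_not_availableFor hA hT hck hav j hj) hu ⟨s, h⟩

theorem state_unique {c : ℕ} {u : ℝ} {s s' : TakerState}
    (h : R.InState c u s) (h' : R.InState c u s') : s = s' := by
  obtain ⟨-, -, h⟩ := h
  obtain ⟨-, -, h'⟩ := h'
  cases s <;> cases s' <;> simp only at h h' <;>
    first
      | rfl
      | (exfalso; have := h.1.symm.trans h'.1; omega)
      | (exfalso; linarith [h.2, h'.2.1])
      | (exfalso; linarith [h.2.1, h'.2])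

/-- There is at most one taker at a time: a new courier is dispatched only when the earlier
ones are unavailable, and then these never become available again. -/
theorem taker_unique (hA : R.NoSimultaneousArrivals) (hT : R.TakersFirst)
    {u : ℝ} {c c' : ℕ} {s s' : TakerState} (h : R.InState c u s) (h' : R.InState c' u s') :
    c = c' ∧ s = s' := by
  have key : ∀ {d d' : ℕ} {r r' : TakerState}, R.InState d u r → R.InState d' u r' → ¬ d < d' := by
    intro d d' r r' hd hd' hlt
    exact not_inState_of_not_availableFor hA hT hlt (hT.2 d' hd'.2.1 d) hd'.1 r hd
  have hc : c = c' := le_antisymm (not_lt.1 (key h' h)) (not_lt.1 (key h h'))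
  subst hc
  exact ⟨rfl, state_unique h h'⟩

/-- While the courier dispatched last is `c`, an order is matched to `c` if she is available and
goes to an idle courier otherwise. -/
theorem partner_eq_of_last_dispatch (hA : R.NoSimultaneousArrivals) (hT : R.TakersFirst) {c k : ℕ}
    (hc : R.partner c = none) (hck : c < k) (hlast : ∀ j, c < j → j < k → R.partner j ≠ none) :
    (R.AvailableFor c k → R.partner k = some c) ∧ (¬ R.AvailableFor c k → R.partner k = none) := by
  have hcase : R.partner k = none ∨ R.partner k = some c := by
    rcases hp : R.partner k with _ | d
    · exact Or.inl rfl
    · right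
      obtain ⟨hd, hdn⟩ := lt_and_partner_eq_none hA hT hp
      rcases lt_trichotomy d c with h | h | h
      · exact absurd hp (partner_ne_of_not_availableFor hA hT h (hT.2 c hc d) k hck.le)
      · rw [h]
      · exact absurd hdn (hlast d h hd)
  constructor
  · exact fun h => hcase.resolve_left fun h0 => hT.2 k h0 c h
  · exact fun h => hcase.resolve_right fun h0 => h (hT.1 k c h0)

end Realization

/-! ### Cycles of a realization -/

/-- Number of orders in the cycle that begins with the dispatch of a courier, as a function of
`(a, f, a', p)`: the next interarrival time, the first pickup time of the courier, the interarrival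
time after the next, and the second pickup time. The order of the entries reflects the order in
which they matter: if `f ≤ a`, then `a'` and `p` do not. -/
noncomputable def cycleLength (y : ℝ × ℝ × ℝ × ℝ) : ℕ :=
  if y.2.1 ≤ y.1 then 1 else if y.1 + y.2.2.1 < y.2.1 + y.2.2.2 then 3 else 2

/-- Time from the dispatch of a courier to the moment she enters a state. If she never enters it,
then this is at least `leaveTime`. -/
def enterTime : TakerState → ℝ × ℝ × ℝ × ℝ → ℝ
  | .one_one, _ => 0
  | .two_one, y => y.1
  | .two_two, y => y.2.1

/-- Time from the dispatch of a courier to the moment she leaves a state. -/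
noncomputable def leaveTime : TakerState → ℝ × ℝ × ℝ × ℝ → ℝ
  | .one_one, y => min y.1 y.2.1
  | .two_one, y => min (y.1 + y.2.2.1) y.2.1
  | .two_two, y =>
      if y.2.1 ≤ y.1 then y.2.1 else min (y.1 + y.2.2.1) (y.2.1 + y.2.2.2)

/-- Length of stay in a state during a cycle. -/
noncomputable def stay (s : TakerState) (y : ℝ × ℝ × ℝ × ℝ) : ℝ :=
  max 0 (leaveTime s y - enterTime s y)

theorem stay_pos_iff {s : TakerState} {y : ℝ × ℝ × ℝ × ℝ} :
    0 < stay s y ↔ enterTime s y < leaveTime s y := by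
  simp [stay]

theorem stay_nonneg (s : TakerState) (y : ℝ × ℝ × ℝ × ℝ) : 0 ≤ stay s y := le_max_left _ _

theorem cycleLength_pos (y : ℝ × ℝ × ℝ × ℝ) : 0 < cycleLength y := by
  unfold cycleLength; split_ifs <;> norm_num

theorem cycleLength_eq_one_iff {y : ℝ × ℝ × ℝ × ℝ} : cycleLength y = 1 ↔ y.2.1 ≤ y.1 := by
  unfold cycleLength; split_ifs <;> simp_all

namespace Realization

/-- The times that determine the cycle beginning with order `c`, if `c` is dispatched to an
idle courier. -/
def cycleData (R : Realization) (c : ℕ) : ℝ × ℝ × ℝ × ℝ :=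
  (R.interarrival (c + 1), R.firstPickup c, R.interarrival (c + 2), R.secondPickup c)

/-- The order with which the `n`-th cycle begins. -/
noncomputable def cycleStart (R : Realization) : ℕ → ℕ
  | 0 => 0
  | n + 1 => R.cycleStart n + cycleLength (R.cycleData (R.cycleStart n))

variable {R : Realization}

theorem arrival_succ (k : ℕ) : R.arrival (k + 1) = R.arrival k + R.interarrival (k + 1) := by
  simp [arrival, Finset.sum_range_succ _ (k + 1)]

theorem cycleStart_strictMono (R : Realization) : StrictMono R.cycleStart :=
  strictMono_nat_of_lt_succ fun n => by
    have := cycleLength_pos (R.cycleData (R.cycleStart n))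
    simp only [cycleStart]; omega

theorem load_eq_card {seen : Set ℕ} {c : ℕ} (F : Finset ℕ)
    (hF : ∀ k, k ∈ F ↔ k ∈ seen ∧ (k = c ∨ R.partner k = some c)) : R.load seen c = F.card := by
  unfold load
  rw [← Set.ncard_coe_finset]
  congr 1
  ext k
  exact (hF k).symm

theorem availableFor_iff (hA : R.NoSimultaneousArrivals) {c k : ℕ} (hck : c < k)
    (hc : R.partner c = none) {m : ℕ} (hl : R.load (Set.Iio k) c = m) :
    R.AvailableFor c k ↔
      ((m = 1 ∧ R.arrival k < R.arrival c + R.firstPickup c) ∨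
       (m = 2 ∧ (R.arrival k < R.arrival c + R.firstPickup c ∨
          R.arrival k < R.arrival c + R.firstPickup c + R.secondPickup c))) := by
  unfold AvailableFor
  rw [exists_inStateGiven_iff, seen_eq_Iio hA, hl]
  simp [hck, hc]

/-- The courses that a cycle beginning with order `c` can take: the courier gets one, two, or three
orders. -/
theorem cycle_cases (hA : R.NoSimultaneousArrivals) (hT : R.TakersFirst)
    (hp : ∀ k, 0 < R.secondPickup k) {c : ℕ} (hc : R.partner c = none) :
    (R.firstPickup c ≤ R.interarrival (c + 1) ∧ cycleLength (R.cycleData c) = 1 ∧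
      R.partner (c + 1) = none ∧ ∀ k, R.partner k ≠ some c) ∨
    (R.interarrival (c + 1) < R.firstPickup c ∧
      R.firstPickup c + R.secondPickup c ≤ R.interarrival (c + 1) + R.interarrival (c + 2) ∧
      cycleLength (R.cycleData c) = 2 ∧ R.partner (c + 2) = none ∧
      ∀ k, R.partner k = some c ↔ k = c + 1) ∨
    (R.interarrival (c + 1) < R.firstPickup c ∧
      R.interarrival (c + 1) + R.interarrival (c + 2) < R.firstPickup c + R.secondPickup c ∧
      cycleLength (R.cycleData c) = 3 ∧ R.partner (c + 3) = none ∧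
      ∀ k, R.partner k = some c ↔ k = c + 1 ∨ k = c + 2) := by
  have hlt : ∀ {k}, R.partner k = some c → c < k := fun h => (lt_and_partner_eq_none hA hT h).1
  have a1 := R.arrival_succ c
  have a2 : R.arrival (c + 2) = _ := R.arrival_succ (c + 1)
  have l1 : R.load (Set.Iio (c + 1)) c = 1 := load_eq_card {c} fun k => by
    simp only [Finset.mem_singleton, Set.mem_Iio]
    constructor
    · rintro rfl; simp
    · rintro ⟨h1, h2 | h2⟩
      · exact h2
      · have := hlt h2; omega
  have av1 := availableFor_iff hA (Nat.lt_succ_self c) hc l1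
  have p1 := partner_eq_of_last_dispatch hA hT hc (Nat.lt_succ_self c) (fun j _ _ => by omega)
  by_cases h1 : R.firstPickup c ≤ R.interarrival (c + 1)
  · left
    have hn : ¬ R.AvailableFor c (c + 1) := by
      rw [av1]
      rintro (⟨-, h⟩ | ⟨h, -⟩)
      · linarith
      · omega
    refine ⟨h1, by simp [cycleLength, cycleData, h1], p1.2 hn, fun k hk => ?_⟩
    exact partner_ne_of_not_availableFor hA hT (Nat.lt_succ_self c) hn k (hlt hk) hk
  right
  have h1' := not_le.1 h1
  have m1 : R.partner (c + 1) = some c := p1.1 (av1.2 (Or.inl ⟨rfl, by linarith⟩))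
  have l2 : R.load (Set.Iio (c + 2)) c = 2 := by
    rw [load_eq_card {c, c + 1}]
    · simp
    · intro k
      simp only [Finset.mem_singleton, Finset.mem_insert, Set.mem_Iio]
      constructor
      · rintro (rfl | rfl)
        · simp
        · exact ⟨by omega, Or.inr m1⟩
      · rintro ⟨h1, h2 | h2⟩
        · exact Or.inl h2
        · have := hlt h2; omega
  have av2 := availableFor_iff hA (show c < c + 2 by omega) hc l2
  have p2 := partner_eq_of_last_dispatch hA hT hc (show c < c + 2 by omega) (fun j _ _ => by
    obtain rfl : j = c + 1 := by omega
    simp [m1])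
  have hpc := hp c
  by_cases h2 : R.interarrival (c + 1) + R.interarrival (c + 2) <
      R.firstPickup c + R.secondPickup c
  · right
    have m2 : R.partner (c + 2) = some c :=
      p2.1 (av2.2 (Or.inr ⟨rfl, Or.inr (by linarith)⟩))
    have l3 : R.load (Set.Iio (c + 3)) c = 3 := by
      rw [load_eq_card {c, c + 1, c + 2}]
      · simp
      · intro k
        simp only [Finset.mem_singleton, Finset.mem_insert, Set.mem_Iio]
        constructor
        · rintro (rfl | rfl | rfl)
          · simp
          · exact ⟨by omega, Or.inr m1⟩
          · exact ⟨by omega, Or.inr m2⟩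
        · rintro ⟨h1, h2 | h2⟩
          · exact Or.inl h2
          · have := hlt h2; omega
    have hn : ¬ R.AvailableFor c (c + 3) := by
      rw [availableFor_iff hA (show c < c + 3 by omega) hc l3]; omega
    refine ⟨h1', h2, by simp [cycleLength, cycleData, h1, h2],
      (partner_eq_of_last_dispatch hA hT hc (show c < c + 3 by omega) (fun j _ _ => ?_)).2 hn,
      fun k => ⟨fun hk => ?_, ?_⟩⟩
    · obtain rfl | rfl : j = c + 1 ∨ j = c + 2 := by omega
      · simp [m1]
      · simp [m2]
    · have := hlt hk
      by_contra hne
      exact partner_ne_of_not_availableFor hA hT (show c < c + 3 by omega) hn k (by omega) hk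
    · rintro (rfl | rfl) <;> assumption
  · left
    have hn : ¬ R.AvailableFor c (c + 2) := by
      rw [av2]
      rintro (⟨h, -⟩ | ⟨-, h | h⟩)
      · omega
      · linarith
      · linarith
    refine ⟨h1', not_lt.1 h2, by simp [cycleLength, cycleData, h1, h2], p2.2 hn,
      fun k => ⟨fun hk => ?_, ?_⟩⟩
    · have := hlt hk
      by_contra hne
      exact partner_ne_of_not_availableFor hA hT (show c < c + 2 by omega) hn k (by omega) hk
    · rintro rfl; exact m1

theorem partner_ne_none_of_mem_cycle (hA : R.NoSimultaneousArrivals) (hT : R.TakersFirst)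
    (hp : ∀ k, 0 < R.secondPickup k) {c : ℕ} (hc : R.partner c = none) {k : ℕ} (hck : c < k)
    (hk : k < c + cycleLength (R.cycleData c)) : R.partner k ≠ none := by
  have hsome : R.partner k = some c → R.partner k ≠ none := fun h => by simp [h]
  rcases cycle_cases hA hT hp hc with ⟨-, h, -⟩ | ⟨-, -, h, -, h'⟩ | ⟨-, -, h, -, h'⟩
  · omega
  · exact hsome ((h' k).2 (by omega))
  · exact hsome ((h' k).2 (by omega))

theorem partner_cycle_end (hA : R.NoSimultaneousArrivals) (hT : R.TakersFirst)
    (hp : ∀ k, 0 < R.secondPickup k) {c : ℕ} (hc : R.partner c = none) :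
    R.partner (c + cycleLength (R.cycleData c)) = none := by
  rcases cycle_cases hA hT hp hc with ⟨-, h, h', -⟩ | ⟨-, -, h, h', -⟩ | ⟨-, -, h, h', -⟩ <;>
    rw [h] <;> exact h'

/-- The orders dispatched to idle couriers are those with which the cycles begin. -/
theorem partner_eq_none_iff (hA : R.NoSimultaneousArrivals) (hT : R.TakersFirst)
    (hp : ∀ k, 0 < R.secondPickup k) (k : ℕ) :
    R.partner k = none ↔ k ∈ Set.range R.cycleStart := by
  have hst : ∀ n, R.partner (R.cycleStart n) = none := by
    intro n
    induction n with
    | zero =>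
      rcases h : R.partner (R.cycleStart 0) with _ | c
      · rfl
      · exact absurd (lt_and_partner_eq_none hA hT h).1 (Nat.not_lt_zero c)
    | succ n ih => exact partner_cycle_end hA hT hp ih
  constructor
  · intro hk
    -- the first cycle that begins after order `k`
    have hex : ∃ n, k < R.cycleStart n := ⟨k + 1, R.cycleStart_strictMono.le_apply (x := k + 1)⟩
    classical
    have h1 := Nat.find_spec hex
    obtain ⟨m, hm⟩ : ∃ m, Nat.find hex = m + 1 := by
      refine Nat.exists_eq_succ_of_ne_zero fun h0 => ?_
      rw [h0] at h1
      exact Nat.not_lt_zero _ h1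
    have h2 : R.cycleStart m ≤ k := not_lt.1 (Nat.find_min hex (by omega))
    rw [hm] at h1
    refine ⟨m, ?_⟩
    by_contra hne
    exact partner_ne_none_of_mem_cycle hA hT hp (hst m) (by omega) h1 hk
  · rintro ⟨n, rfl⟩
    exact hst n

/-- The period that a courier spends in a state is the interval given by `enterTime` and
`leaveTime`. -/
theorem inState_iff (hA : R.NoSimultaneousArrivals) (hT : R.TakersFirst)
    (hp : ∀ k, 0 < R.secondPickup k) {c : ℕ} (hc : R.partner c = none) (u : ℝ)
    (s : TakerState) :
    R.InState c u s ↔ R.arrival c + enterTime s (R.cycleData c) ≤ u ∧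
      u < R.arrival c + leaveTime s (R.cycleData c) := by
  have a1 := R.arrival_succ c
  have a2 : R.arrival (c + 2) = _ := R.arrival_succ (c + 1)
  have hlt1 : R.arrival c < R.arrival (c + 1) := hA (by omega)
  have hlt2 : R.arrival (c + 1) < R.arrival (c + 2) := hA (by omega)
  have hpc := hp c
  -- the number of orders dispatched so far, in terms of the times of the arrivals
  have hload : ∀ F : Finset ℕ, (∀ k, k ∈ F ↔ k = c ∨ R.partner k = some c) →
      R.load {l | R.arrival l ≤ u} c = ∑ k ∈ F, if R.arrival k ≤ u then 1 else 0 := fun F hF => by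
    rw [← Finset.card_filter]
    exact load_eq_card _ fun k => by simp [hF, and_comm]
  have hmin : ∀ x y : ℝ, u < R.arrival c + min x y ↔ u < R.arrival c + x ∧ u < R.arrival c + y :=
    fun x y => by rw [← min_add_add_left, lt_min_iff]
  unfold InState InStateGiven
  simp only [Set.mem_ofPred_eq, hc, true_and]
  rcases cycle_cases hA hT hp hc with ⟨h1, -, -, h'⟩ | ⟨h1, h2, -, -, h'⟩ | ⟨h1, h2, -, -, h'⟩
  · rw [hload {c} (by simp [h']), Finset.sum_singleton]
    cases s <;> simp only [enterTime, leaveTime, cycleData, h1, if_true, hmin] <;> grind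
  · rw [hload {c, c + 1} (by simp [h']), Finset.sum_pair (by omega)]
    cases s <;> simp only [enterTime, leaveTime, cycleData, not_le.2 h1, if_false, hmin] <;> grind
  · rw [hload {c, c + 1, c + 2} (by simp [h']), Finset.sum_insert (by simp),
      Finset.sum_pair (by omega)]
    cases s <;> simp only [enterTime, leaveTime, cycleData, not_le.2 h1, if_false, hmin] <;> grind

end Realization

/-! ### Long-run quantities of a realization as ratios of cycle averages -/

/-- The index of the first term of `b` that exceeds `x`. -/
theorem exists_first_exceeding {b : ℕ → ℝ} (hb : Tendsto b atTop atTop) :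
    ∃ N : ℝ → ℕ, ∀ x, x < b (N x) ∧ ∀ m < N x, b m ≤ x := by
  classical
  have hex : ∀ x, ∃ n, x < b n := fun x => (hb.eventually_gt_atTop x).exists
  exact ⟨fun x => Nat.find (hex x), fun x => ⟨Nat.find_spec (hex x),
    fun m hm => not_lt.1 (Nat.find_min (hex x) hm)⟩⟩

/-- If a quantity lies between consecutive terms of a sequence of asymptotic slope `α`, then its
ratio to the index tends to `α`. -/
theorem tendsto_div_index {S : ℕ → ℝ} {α : ℝ}
    (hS : Tendsto (fun n : ℕ => S n / n) atTop (𝓝 α)) {ι : Type*} {l : Filter ι} {N : ι → ℕ}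
    (hN : Tendsto N l atTop) {f : ι → ℝ}
    (h : ∀ᶠ i in l, S (N i - 1) ≤ f i ∧ f i ≤ S (N i)) :
    Tendsto (fun i => f i / N i) l (𝓝 α) := by
  have h1 : Tendsto (fun n : ℕ => S (n - 1) / n) atTop (𝓝 α) := by
    rw [← tendsto_add_atTop_iff_nat 1]
    have h2 := hS.mul (tendsto_natCast_div_add_atTop (𝕜 := ℝ) (1 : ℝ))
    rw [mul_one] at h2
    refine h2.congr' ?_
    filter_upwards [eventually_ne_atTop 0] with n hn
    have : (n : ℝ) ≠ 0 := by exact_mod_cast hn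
    push_cast
    field_simp
  refine tendsto_of_tendsto_of_tendsto_of_le_of_le' (h1.comp hN) (hS.comp hN) ?_ ?_
  · filter_upwards [h] with i hi
    exact div_le_div_of_nonneg_right hi.1 (Nat.cast_nonneg _)
  · filter_upwards [h] with i hi
    exact div_le_div_of_nonneg_right hi.2 (Nat.cast_nonneg _)

/-- The index at which a monotone sequence passes a diverging level tends to infinity. -/
theorem tendsto_index {b : ℕ → ℝ} (hb : Monotone b) {ι : Type*} {l : Filter ι} {N : ι → ℕ}
    {v : ι → ℝ} (hv : Tendsto v l atTop) (h : ∀ i, v i ≤ b (N i)) : Tendsto N l atTop := by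
  rw [tendsto_atTop]
  intro m
  filter_upwards [hv.eventually_gt_atTop (b m)] with i hi
  by_contra hlt
  exact absurd (hi.trans_le (h i)) (not_lt.2 (hb (not_le.1 hlt).le))

theorem tendsto_atTop_of_div {b : ℕ → ℝ} {β : ℝ} (hβ : 0 < β)
    (hb : Tendsto (fun n : ℕ => b n / n) atTop (𝓝 β)) : Tendsto b atTop atTop := by
  refine (hb.pos_mul_atTop hβ tendsto_natCast_atTop_atTop).congr' ?_
  filter_upwards [eventually_ne_atTop 0] with n hn
  have : (n : ℝ) ≠ 0 := by exact_mod_cast hn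
  field_simp

theorem tendsto_div_of_div_index {ι : Type*} {l : Filter ι} {N : ι → ℕ} {f v : ι → ℝ} {α β : ℝ}
    (hN : Tendsto N l atTop) (hβ : β ≠ 0) (hf : Tendsto (fun i => f i / N i) l (𝓝 α))
    (hv : Tendsto (fun i => v i / N i) l (𝓝 β)) : Tendsto (fun i => f i / v i) l (𝓝 (α / β)) := by
  refine (hf.div hv hβ).congr' ?_
  filter_upwards [hN.eventually_ne_atTop 0] with i hi
  have : (N i : ℝ) ≠ 0 := by exact_mod_cast hi
  exact div_div_div_cancel_right₀ this _ _

namespace Realization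

/-- The properties of a realization that hold almost surely and that determine the matching. -/
structure Regular (R : Realization) : Prop where
  strictMono : R.NoSimultaneousArrivals
  takersFirst : R.TakersFirst
  secondPickup_pos : ∀ k, 0 < R.secondPickup k
  arrival_zero_nonneg : 0 ≤ R.arrival 0

variable {R : Realization}

/-- The period of the `n`-th cycle during which there is a taker in state `s`. -/
def stayInterval (R : Realization) (s : TakerState) (n : ℕ) : Set ℝ :=
  Set.Ico (R.arrival (R.cycleStart n) + enterTime s (R.cycleData (R.cycleStart n)))
    (R.arrival (R.cycleStart n) + leaveTime s (R.cycleData (R.cycleStart n)))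

theorem volume_stayInterval (s : TakerState) (n : ℕ) :
    volume.real (R.stayInterval s n) = stay s (R.cycleData (R.cycleStart n)) := by
  rw [stayInterval, measureReal_def, Real.volume_Ico, ENNReal.toReal_ofReal', stay, max_comm]
  congr 1; ring

theorem stayInterval_subset (hA : R.NoSimultaneousArrivals) (s : TakerState) (n : ℕ) :
    R.stayInterval s n ⊆
      Set.Ico (R.arrival (R.cycleStart n)) (R.arrival (R.cycleStart (n + 1))) := by
  rintro u ⟨h1, h2⟩
  simp only [cycleStart]
  set c := R.cycleStart n
  have a1 := R.arrival_succ c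
  have a2 : R.arrival (c + 2) = _ := R.arrival_succ (c + 1)
  have hlt1 : R.arrival c < R.arrival (c + 1) := hA (by omega)
  have hlt2 : R.arrival (c + 1) < R.arrival (c + 2) := hA (by omega)
  have hlt3 : R.arrival (c + 2) < R.arrival (c + 3) := hA (by omega)
  have hmin : ∀ x y : ℝ, u < R.arrival c + min x y ↔ u < R.arrival c + x ∧ u < R.arrival c + y :=
    fun x y => by rw [← min_add_add_left, lt_min_iff]
  unfold cycleLength
  cases s <;> simp only [enterTime, leaveTime, cycleData, hmin] at h1 h2 ⊢ <;> split_ifs at h2 ⊢ <;>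
    constructor <;> grind

theorem takerExists_iff (hR : R.Regular) (s : TakerState) (u : ℝ) :
    R.TakerExists s u ↔ ∃ n, u ∈ R.stayInterval s n := by
  constructor
  · rintro ⟨c, hc⟩
    have h0 := hc.2.1
    obtain ⟨n, rfl⟩ := (partner_eq_none_iff hR.1 hR.2 hR.3 c).1 h0
    exact ⟨n, (inState_iff hR.1 hR.2 hR.3 h0 u s).1 hc⟩
  · rintro ⟨n, hn⟩
    have h0 := (partner_eq_none_iff hR.1 hR.2 hR.3 _).2 ⟨n, rfl⟩
    exact ⟨_, (inState_iff hR.1 hR.2 hR.3 h0 u s).2 hn⟩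

theorem dwellTime_cycleStart (hR : R.Regular) (s : TakerState) (n : ℕ) :
    R.dwellTime s (R.cycleStart n) = stay s (R.cycleData (R.cycleStart n)) := by
  rw [← volume_stayInterval, dwellTime]
  congr 1
  ext u
  exact inState_iff hR.1 hR.2 hR.3 ((partner_eq_none_iff hR.1 hR.2 hR.3 _).2 ⟨n, rfl⟩) u s

theorem arrival_cycleStart_nonneg (hR : R.Regular) (n : ℕ) : 0 ≤ R.arrival (R.cycleStart n) :=
  hR.arrival_zero_nonneg.trans (hR.strictMono.monotone (Nat.zero_le _))

/-- Up to a time before the `N`-th cycle, takers exist during at most the first `N` cycles. -/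
theorem existence_le (hR : R.Regular) (s : TakerState) {u : ℝ} {N : ℕ}
    (hN : u < R.arrival (R.cycleStart N)) :
    volume.real {r ∈ Set.Icc 0 u | R.TakerExists s r} ≤
      ∑ n ∈ Finset.range N, stay s (R.cycleData (R.cycleStart n)) := by
  simp only [← volume_stayInterval]
  refine (measureReal_mono ?_ ?_).trans (measureReal_biUnion_finset_le _ _)
  · rintro r ⟨h1, h2⟩
    obtain ⟨n, hn⟩ := (takerExists_iff hR s r).1 h2
    refine Set.mem_biUnion (x := n) ?_ hn
    have h3 := (stayInterval_subset hR.1 s n hn).1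
    have h4 := (hR.1.comp R.cycleStart_strictMono).lt_iff_lt.1 (h3.trans_lt (h1.2.trans_lt hN))
    simpa using h4
  · refine ((measure_biUnion_finset_le _ _).trans_lt (ENNReal.sum_lt_top.2 fun n _ => ?_)).ne
    exact measure_Ico_lt_top

/-- All cycles but the last of those begun by time `u` are completed by then, and count in full. -/
theorem le_existence (hR : R.Regular) (s : TakerState) {u : ℝ} {N : ℕ}
    (hN : ∀ m < N, R.arrival (R.cycleStart m) ≤ u) :
    ∑ n ∈ Finset.range (N - 1), stay s (R.cycleData (R.cycleStart n)) ≤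
      volume.real {r ∈ Set.Icc 0 u | R.TakerExists s r} := by
  simp only [← volume_stayInterval]
  rw [← measureReal_biUnion_finset (s := Finset.range (N - 1)) (f := R.stayInterval s)
    (h := fun n _ => measure_Ico_lt_top.ne)]
  · refine measureReal_mono ?_ ?_
    · intro r hr
      simp only [Set.mem_iUnion, Finset.mem_range] at hr
      obtain ⟨n, hn, hr⟩ := hr
      obtain ⟨h1, h2⟩ := stayInterval_subset hR.1 s n hr
      exact ⟨⟨(arrival_cycleStart_nonneg hR n).trans h1, h2.le.trans (hN (n + 1) (by omega))⟩,
        (takerExists_iff hR s r).2 ⟨n, hr⟩⟩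
    · exact ((measure_mono (fun r hr => hr.1)).trans_lt
        (measure_Icc_lt_top (a := (0 : ℝ)) (b := u))).ne
  · intro m _ n _ hmn
    refine Set.disjoint_left.2 fun r hm hn => hmn ?_
    have hb := (hR.1.comp R.cycleStart_strictMono)
    obtain ⟨h1, h2⟩ := stayInterval_subset hR.1 s m hm
    obtain ⟨h3, h4⟩ := stayInterval_subset hR.1 s n hn
    have h5 := hb.lt_iff_lt.1 (h1.trans_lt h4)
    have h6 := hb.lt_iff_lt.1 (h3.trans_lt h2)
    omega
  · exact fun n _ => measurableSet_Ico

/-- The takers that have entered a state belong to a cycle begun by then, and include all those of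
the completed cycles. -/
theorem exists_entered_eq (hR : R.Regular) (s : TakerState) {u : ℝ} {N : ℕ}
    (hN : u < R.arrival (R.cycleStart N)) (hN' : ∀ m < N, R.arrival (R.cycleStart m) ≤ u) :
    ∃ A : Finset ℕ, A ⊆ Finset.range N ∧ (∀ n ∈ A, 0 < stay s (R.cycleData (R.cycleStart n))) ∧
      (∀ n < N - 1, 0 < stay s (R.cycleData (R.cycleStart n)) → n ∈ A) ∧
      R.entered s u = R.cycleStart '' A := by
  classical
  refine ⟨(Finset.range N).filter fun n => ∃ r ≤ u, r ∈ R.stayInterval s n,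
    Finset.filter_subset _ _, ?_, ?_, ?_⟩
  · intro n hn
    obtain ⟨r, -, hr⟩ := (Finset.mem_filter.1 hn).2
    rw [stay_pos_iff]
    have := hr.1.trans_lt hr.2
    linarith
  · intro n hn hpos
    rw [stay_pos_iff] at hpos
    have hmem : R.arrival (R.cycleStart n) + enterTime s (R.cycleData (R.cycleStart n)) ∈
        R.stayInterval s n := ⟨le_rfl, by linarith⟩
    exact Finset.mem_filter.2 ⟨Finset.mem_range.2 (by omega), _,
      (stayInterval_subset hR.1 s n hmem).2.le.trans (hN' (n + 1) (by omega)), hmem⟩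
  · ext c
    simp only [entered, Set.mem_ofPred_eq, Set.mem_image, Finset.coe_filter, Finset.mem_range]
    constructor
    · rintro ⟨r, hru, hr⟩
      have h0 := hr.2.1
      obtain ⟨n, rfl⟩ := (partner_eq_none_iff hR.1 hR.2 hR.3 c).1 h0
      have hr' : r ∈ R.stayInterval s n := (inState_iff hR.1 hR.2 hR.3 h0 r s).1 hr
      refine ⟨n, ⟨?_, r, hru, hr'⟩, rfl⟩
      exact (hR.1.comp R.cycleStart_strictMono).lt_iff_lt.1
        ((stayInterval_subset hR.1 s n hr').1.trans_lt (hru.trans_lt hN))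
    · rintro ⟨n, ⟨-, r, hru, hr⟩, rfl⟩
      exact ⟨r, hru, (inState_iff hR.1 hR.2 hR.3
        ((partner_eq_none_iff hR.1 hR.2 hR.3 _).2 ⟨n, rfl⟩) r s).2 hr⟩

/-- A sum over the takers that have entered a state of a function of their stay, with `φ 0 = 0`, lies
between the sum over the completed cycles and the sum over the cycles begun. This is used with the
identity, and with the indicator of the positive numbers to count the takers. -/
theorem entered_bounds (hR : R.Regular) (s : TakerState) {u : ℝ} {N : ℕ}
    (hN : u < R.arrival (R.cycleStart N)) (hN' : ∀ m < N, R.arrival (R.cycleStart m) ≤ u)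
    (φ : ℝ → ℝ) (hφ0 : ∀ x, 0 ≤ φ x) (hφ : φ 0 = 0) :
    ∑ n ∈ Finset.range (N - 1), φ (stay s (R.cycleData (R.cycleStart n))) ≤
        ∑ᶠ c ∈ R.entered s u, φ (R.dwellTime s c) ∧
      ∑ᶠ c ∈ R.entered s u, φ (R.dwellTime s c) ≤
        ∑ n ∈ Finset.range N, φ (stay s (R.cycleData (R.cycleStart n))) := by
  obtain ⟨A, hAN, hApos, hAmem, hA⟩ := exists_entered_eq hR s hN hN'
  rw [hA, finsum_mem_image R.cycleStart_strictMono.injective.injOn, finsum_mem_coe_finset]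
  simp only [dwellTime_cycleStart hR]
  refine ⟨?_, Finset.sum_le_sum_of_subset_of_nonneg hAN fun _ _ _ => hφ0 _⟩
  have h1 : ∑ n ∈ (Finset.range (N - 1)).filter (fun n => n ∈ A),
        φ (stay s (R.cycleData (R.cycleStart n))) =
      ∑ n ∈ Finset.range (N - 1), φ (stay s (R.cycleData (R.cycleStart n))) := by
    refine Finset.sum_filter_of_ne fun n hn hne => hAmem n (Finset.mem_range.1 hn) ?_
    refine lt_of_le_of_ne (stay_nonneg _ _) fun h0 => hne ?_
    rw [← h0, hφ]
  rw [← h1]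
  exact Finset.sum_le_sum_of_subset_of_nonneg (fun n hn => (Finset.mem_filter.1 hn).2)
    fun _ _ _ => hφ0 _

theorem dwellTime_pos_and_finite_entered (hR : R.Regular) (s : TakerState) {u : ℝ} {N : ℕ}
    (hN : u < R.arrival (R.cycleStart N)) (hN' : ∀ m < N, R.arrival (R.cycleStart m) ≤ u) :
    (∀ c ∈ R.entered s u, 0 < R.dwellTime s c) ∧ (R.entered s u).Finite := by
  obtain ⟨A, -, hApos, -, hA⟩ := exists_entered_eq hR s hN hN'
  rw [hA]
  refine ⟨?_, A.finite_toSet.image _⟩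
  rintro c ⟨n, hn, rfl⟩
  rw [dwellTime_cycleStart hR]
  exact hApos n hn

/-- If `N` cycles begin before order `n`, then the other `n - N` orders up to then are matched. -/
theorem ncard_matched (hR : R.Regular) {n N : ℕ} (hN : n ≤ R.cycleStart N)
    (hN' : ∀ m < N, R.cycleStart m < n) :
    (Set.ncard {k | k < n ∧ R.partner k ≠ none} : ℝ) = n - N := by
  classical
  have h1 : {k | k < n ∧ R.partner k ≠ none} =
      ((Finset.range n \ (Finset.range N).image R.cycleStart : Finset ℕ) : Set ℕ) := by
    ext k
    simp only [Set.mem_ofPred_eq, ne_eq, partner_eq_none_iff hR.1 hR.2 hR.3, Set.mem_range,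
      Finset.coe_sdiff, Finset.coe_range, Finset.coe_image, Set.mem_sdiff, Set.mem_Iio, Set.mem_image]
    refine and_congr_right fun hk => not_congr ⟨?_, ?_⟩
    · rintro ⟨m, rfl⟩
      exact ⟨m, R.cycleStart_strictMono.lt_iff_lt.1 (hk.trans_le hN), rfl⟩
    · rintro ⟨m, -, hm⟩
      exact ⟨m, hm⟩
  have h2 : (Finset.range N).image R.cycleStart ⊆ Finset.range n := by
    intro k hk
    obtain ⟨m, hm, rfl⟩ := Finset.mem_image.1 hk
    exact Finset.mem_range.2 (hN' m (Finset.mem_range.1 hm))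
  have h3 : ((Finset.range N).image R.cycleStart).card = N := by
    rw [Finset.card_image_of_injective _ R.cycleStart_strictMono.injective, Finset.card_range]
  have h4 := Finset.card_le_card h2
  rw [h1, Set.ncard_coe_finset, Finset.card_sdiff_of_subset h2, Nat.cast_sub h4, h3,
    Finset.card_range]

theorem tendsto_matchedFraction (hR : R.Regular) {len : ℝ} (hlen : 0 < len)
    (hL : Tendsto (fun n : ℕ => (R.cycleStart n : ℝ) / n) atTop (𝓝 len)) :
    Tendsto R.matchedFraction atTop (𝓝 (1 - 1 / len)) := by
  classical
  have hex : ∀ n, ∃ m, n ≤ R.cycleStart m := fun n => ⟨n, R.cycleStart_strictMono.le_apply⟩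
  let N : ℕ → ℕ := fun n => Nat.find (hex n)
  have hN : ∀ n, n ≤ R.cycleStart (N n) := fun n => Nat.find_spec (hex n)
  have hN' : ∀ n, ∀ m < N n, R.cycleStart m < n := fun n m hm =>
    not_le.1 (Nat.find_min (hex n) hm)
  have htop : Tendsto N atTop atTop :=
    tendsto_index (b := fun n => (R.cycleStart n : ℝ))
      (fun _ _ h => Nat.cast_le.2 <| R.cycleStart_strictMono.monotone h)
      tendsto_natCast_atTop_atTop (fun n => by exact_mod_cast hN n)
  have h1 : Tendsto (fun n : ℕ => (n : ℝ) / N n) atTop (𝓝 len) := by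
    refine tendsto_div_index hL htop ?_
    filter_upwards [htop.eventually_ne_atTop 0] with n hn
    exact ⟨by exact_mod_cast (hN' n (N n - 1) (by omega)).le, by exact_mod_cast hN n⟩
  have h2 : Tendsto (fun n : ℕ => (N n : ℝ) / N n) atTop (𝓝 1) := by
    refine tendsto_const_nhds.congr' ?_
    filter_upwards [htop.eventually_ne_atTop 0] with n hn
    rw [div_self (by exact_mod_cast hn)]
  refine ((tendsto_div_of_div_index htop hlen.ne' h2 h1).const_sub 1).congr' ?_
  filter_upwards [eventually_ne_atTop 0] with n hn
  have : (n : ℝ) ≠ 0 := by exact_mod_cast hn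
  rw [matchedFraction, ncard_matched hR (hN n) (hN' n), sub_div, div_self this]

/-- The long-run quantities of a realization are those of the average cycle: `len` is the mean
number of orders and `len * β` the mean duration of a cycle, `γ` the mean stay in state `s`, and `π`
the frequency of the cycles that visit `s`. -/
theorem tendsto_of_cycle_averages (hR : R.Regular) (s : TakerState) {len β γ π : ℝ}
    (hlen : 0 < len) (hβ : 0 < β) (hπ : π ≠ 0)
    (hL : Tendsto (fun n : ℕ => (R.cycleStart n : ℝ) / n) atTop (𝓝 len))
    (hA : Tendsto (fun n : ℕ => R.arrival n / n) atTop (𝓝 β))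
    (hγ : Tendsto (fun n : ℕ =>
      (∑ m ∈ Finset.range n, stay s (R.cycleData (R.cycleStart m))) / n) atTop (𝓝 γ))
    (hπs : Tendsto (fun n : ℕ => (∑ m ∈ Finset.range n,
      if 0 < stay s (R.cycleData (R.cycleStart m)) then (1 : ℝ) else 0) / n) atTop (𝓝 π)) :
    Tendsto (R.existenceFraction s) atTop (𝓝 (γ / (β * len))) ∧
    Tendsto (R.entryRate s) atTop (𝓝 (π / (β * len))) ∧
    Tendsto (R.meanDwellTime s) atTop (𝓝 (γ / π)) := by
  have hbmono : StrictMono fun n => R.arrival (R.cycleStart n) :=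
    hR.1.comp R.cycleStart_strictMono
  have hb : Tendsto (fun n : ℕ => R.arrival (R.cycleStart n) / n) atTop (𝓝 (β * len)) := by
    refine ((hA.comp R.cycleStart_strictMono.tendsto_atTop).mul hL).congr' ?_
    filter_upwards [R.cycleStart_strictMono.tendsto_atTop.eventually_ne_atTop 0] with n hn
    have : (R.cycleStart n : ℝ) ≠ 0 := by exact_mod_cast hn
    simp only [Function.comp]
    field_simp
  have hpos : 0 < β * len := mul_pos hβ hlen
  obtain ⟨N, hN⟩ := exists_first_exceeding (tendsto_atTop_of_div hpos hb)
  have htop : Tendsto N atTop atTop :=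
    tendsto_index hbmono.monotone tendsto_id (fun u => (hN u).1.le)
  have hv : Tendsto (fun u : ℝ => u / N u) atTop (𝓝 (β * len)) := by
    refine tendsto_div_index hb htop ?_
    filter_upwards [htop.eventually_ne_atTop 0] with u hu
    exact ⟨(hN u).2 _ (by omega), (hN u).1.le⟩
  have hex : Tendsto (fun u : ℝ => volume.real {r ∈ Set.Icc 0 u | R.TakerExists s r} / N u) atTop
      (𝓝 γ) :=
    tendsto_div_index hγ htop (Eventually.of_forall fun u =>
      ⟨le_existence hR s (hN u).2, existence_le hR s (hN u).1⟩)
  have hdw : Tendsto (fun u : ℝ => (∑ᶠ c ∈ R.entered s u, R.dwellTime s c) / N u) atTop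
      (𝓝 γ) := by
    refine tendsto_div_index hγ htop (Eventually.of_forall fun u => ?_)
    -- `max 0` in place of the identity meets the hypothesis of nonnegativity everywhere
    have h := entered_bounds hR s (hN u).1 (hN u).2 (fun x => max 0 x) (fun x => le_max_left _ _)
      (by simp)
    simpa only [dwellTime, measureReal_nonneg, max_eq_right, stay_nonneg] using h
  have hen : Tendsto (fun u : ℝ => ((R.entered s u).ncard : ℝ) / N u) atTop (𝓝 π) := by
    refine tendsto_div_index hπs htop (Eventually.of_forall fun u => ?_)
    have h := entered_bounds hR s (hN u).1 (hN u).2 (fun x => if 0 < x then 1 else 0)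
      (fun x => by positivity) (by simp)
    obtain ⟨hd, hfin⟩ := dwellTime_pos_and_finite_entered hR s (hN u).1 (hN u).2
    have h2 : ∑ᶠ c ∈ R.entered s u, (if 0 < R.dwellTime s c then (1 : ℝ) else 0) =
        (R.entered s u).ncard := by
      rw [finsum_mem_congr rfl fun c hc => if_pos (hd c hc), finsum_mem_eq_finite_toFinset_sum _ hfin,
        Finset.sum_const, Set.ncard_eq_toFinset_card _ hfin]
      simp
    rw [← h2]
    exact h
  exact ⟨tendsto_div_of_div_index htop hpos.ne' hex hv,
    tendsto_div_of_div_index htop hpos.ne' hen hv, tendsto_div_of_div_index htop hπ hdw hen⟩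

end Realization

/-! ### Exponential integrals and the means of a cycle -/

open scoped ENNReal in
theorem lintegral_expMeasure (r : ℝ) {h : ℝ → ℝ≥0∞} (hh : Measurable h) :
    ∫⁻ x, h x ∂(expMeasure r) =
      ∫⁻ x in Set.Ioi 0, ENNReal.ofReal (r * Real.exp (-(r * x))) * h x := by
  have h0 : expMeasure r = volume.withDensity (exponentialPDF r) := rfl
  have hm : Measurable (exponentialPDF r) := by unfold exponentialPDF; fun_prop
  rw [h0, lintegral_withDensity_eq_lintegral_mul _ hm hh, ← lintegral_indicator measurableSet_Ioi]
  refine lintegral_congr_ae ?_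
  filter_upwards [Measure.ae_ne volume (0 : ℝ)] with x hx
  rcases lt_or_gt_of_ne hx with h | h
  · simp [exponentialPDF_of_neg h, h.le]
  · simp [exponentialPDF_of_nonneg h.le, h]

theorem lintegral_Ioi_exp {r : ℝ} (hr : 0 < r) :
    ∫⁻ x in Set.Ioi 0, ENNReal.ofReal (Real.exp (-(r * x))) = ENNReal.ofReal (1 / r) := by
  have h1 := lintegral_expMeasure r (h := fun _ => 1) measurable_const
  have := isProbabilityMeasure_expMeasure hr
  simp only [lintegral_const, measure_univ, mul_one, ENNReal.ofReal_mul hr.le] at h1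
  rw [lintegral_const_mul _ (by fun_prop)] at h1
  rw [one_div, ENNReal.ofReal_inv_of_pos hr]
  exact ENNReal.eq_inv_of_mul_eq_one_left (by rw [mul_comm]; exact h1.symm)

theorem expMeasure_ae_pos (r : ℝ) : ∀ᵐ x ∂(expMeasure r), 0 < x := by
  rw [ae_iff, ← lintegral_indicator_one (by simp only [not_lt]; exact measurableSet_Iic),
    lintegral_expMeasure r (by
      refine measurable_one.indicator ?_; simp only [not_lt]; exact measurableSet_Iic)]
  refine (setLIntegral_congr_fun measurableSet_Ioi fun x hx => ?_).trans lintegral_zero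
  simp [Set.mem_Ioi.1 hx]

theorem lintegral_exp_expMeasure {r s : ℝ} (hr : 0 < r) (hs : 0 < s) :
    ∫⁻ x, ENNReal.ofReal (Real.exp (-(s * x))) ∂(expMeasure r) = ENNReal.ofReal (r / (r + s)) := by
  rw [lintegral_expMeasure r (by fun_prop)]
  have h1 : ∀ x : ℝ, ENNReal.ofReal (r * Real.exp (-(r * x))) * ENNReal.ofReal (Real.exp (-(s * x)))
      = ENNReal.ofReal r * ENNReal.ofReal (Real.exp (-((r + s) * x))) := fun x => by
    rw [← ENNReal.ofReal_mul (by positivity), ← ENNReal.ofReal_mul hr.le, mul_assoc, ← Real.exp_add]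
    congr 3; ring
  simp only [h1]
  rw [lintegral_const_mul _ (by fun_prop), lintegral_Ioi_exp (by positivity),
    ← ENNReal.ofReal_mul hr.le]
  congr 1; ring

open scoped ENNReal in
/-- Memorylessness: beyond `x`, an exponential variable is `x` plus an exponential variable. -/
theorem lintegral_expMeasure_overshoot (r : ℝ) {x : ℝ} (hx : 0 ≤ x) {h : ℝ → ℝ≥0∞}
    (hh : Measurable h) :
    ∫⁻ y, (if x < y then h (y - x) else 0) ∂(expMeasure r) =
      ENNReal.ofReal (Real.exp (-(r * x))) * ∫⁻ y, h y ∂(expMeasure r) := by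
  have hm : Measurable fun y => if x < y then h (y - x) else 0 :=
    Measurable.ite measurableSet_Ioi (by fun_prop) measurable_const
  rw [lintegral_expMeasure r hm, lintegral_expMeasure r hh, ← lintegral_const_mul _ (by fun_prop),
    ← lintegral_indicator measurableSet_Ioi, ← lintegral_indicator measurableSet_Ioi,
    ← lintegral_add_right_eq_self _ x]
  refine lintegral_congr fun y => ?_
  by_cases hy : 0 < y
  · have h1 : 0 < y + x := by linarith
    simp only [Set.indicator, Set.mem_Ioi, h1, hy, if_true, lt_add_iff_pos_left,
      add_sub_cancel_right]
    rw [← mul_assoc, ← ENNReal.ofReal_mul (by positivity)]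
    congr 2
    rw [mul_left_comm, ← Real.exp_add]
    congr 2; ring
  · simp [Set.indicator, hy]

open scoped ENNReal in
/-- If two independent exponential variables have rates `r` and `s`, then the second is larger with
probability `r / (r + s)`, and then exceeds the first by an exponential variable of rate `s`. -/
theorem lintegral_lintegral_overshoot {r s : ℝ} (hr : 0 < r) (hs : 0 < s) {h : ℝ → ℝ≥0∞}
    (hh : Measurable h) :
    ∫⁻ x, ∫⁻ y, (if x < y then h (y - x) else 0) ∂(expMeasure s) ∂(expMeasure r) =
      ENNReal.ofReal (r / (r + s)) * ∫⁻ y, h y ∂(expMeasure s) := by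
  rw [← lintegral_exp_expMeasure hr hs, ← lintegral_mul_const _ (by fun_prop)]
  refine lintegral_congr_ae ?_
  filter_upwards [expMeasure_ae_pos r] with x hx
  exact lintegral_expMeasure_overshoot s hx.le hh

theorem expMeasure_Ioi {r : ℝ} (hr : 0 < r) {x : ℝ} (hx : 0 ≤ x) :
    expMeasure r (Set.Ioi x) = ENNReal.ofReal (Real.exp (-(r * x))) := by
  have := isProbabilityMeasure_expMeasure hr
  have h := lintegral_expMeasure_overshoot r hx (h := fun _ => 1) measurable_const
  rw [lintegral_const, measure_univ, mul_one, mul_one] at h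
  rw [← h, ← lintegral_indicator_one measurableSet_Ioi]
  rfl

theorem lintegral_id_expMeasure {r : ℝ} (hr : 0 < r) :
    ∫⁻ x, ENNReal.ofReal x ∂(expMeasure r) = ENNReal.ofReal (1 / r) := by
  rw [lintegral_eq_lintegral_meas_lt _ ((expMeasure_ae_pos r).mono fun _ h => h.le) (by fun_prop),
    ← lintegral_Ioi_exp hr]
  exact setLIntegral_congr_fun measurableSet_Ioi fun x hx => expMeasure_Ioi hr (le_of_lt hx)

theorem lintegral_min_expMeasure {r s : ℝ} (hr : 0 < r) (hs : 0 < s) :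
    ∫⁻ x, ∫⁻ y, ENNReal.ofReal (min x y) ∂(expMeasure s) ∂(expMeasure r) =
      ENNReal.ofReal (1 / (r + s)) := by
  have := isProbabilityMeasure_expMeasure hr
  have := isProbabilityMeasure_expMeasure hs
  rw [← lintegral_prod (fun z : ℝ × ℝ => ENNReal.ofReal (min z.1 z.2)) (by fun_prop),
    lintegral_eq_lintegral_meas_lt _ _ (by fun_prop), ← lintegral_Ioi_exp (add_pos hr hs)]
  · refine setLIntegral_congr_fun measurableSet_Ioi fun x hx => ?_
    have h1 : {z : ℝ × ℝ | x < min z.1 z.2} = Set.Ioi x ×ˢ Set.Ioi x := by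
      ext z; simp
    have hx0 : 0 ≤ x := le_of_lt hx
    rw [h1, Measure.prod_prod, expMeasure_Ioi hr hx0, expMeasure_Ioi hs hx0,
      ← ENNReal.ofReal_mul (by positivity), ← Real.exp_add]
    congr 2; ring
  · have h1 : ∀ᵐ z ∂((expMeasure r).prod (expMeasure s)), 0 < z.1 :=
      Measure.quasiMeasurePreserving_fst.ae (expMeasure_ae_pos r)
    have h2 : ∀ᵐ z ∂((expMeasure r).prod (expMeasure s)), 0 < z.2 :=
      Measure.quasiMeasurePreserving_snd.ae (expMeasure_ae_pos s)
    filter_upwards [h1, h2] with z h1 h2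
    exact (lt_min h1 h2).le

/-- The law of the times that determine a cycle. -/
noncomputable def cycleLaw (lam w t : ℝ) : Measure (ℝ × ℝ × ℝ × ℝ) :=
  (expMeasure lam).prod ((expMeasure (1 / w)).prod ((expMeasure lam).prod (expMeasure (1 / t))))

theorem measurable_cycleLength : Measurable cycleLength := by
  unfold cycleLength
  refine Measurable.ite (measurableSet_le (by fun_prop) (by fun_prop)) measurable_const ?_
  exact Measurable.ite (measurableSet_lt (by fun_prop) (by fun_prop)) measurable_const
    measurable_const

theorem measurable_enterTime (s : TakerState) : Measurable (enterTime s) := by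
  cases s <;> unfold enterTime <;> fun_prop

theorem measurable_leaveTime (s : TakerState) : Measurable (leaveTime s) := by
  cases s <;> unfold leaveTime
  · fun_prop
  · fun_prop
  · exact Measurable.ite (measurableSet_le (by fun_prop) (by fun_prop)) (by fun_prop) (by fun_prop)

theorem measurable_stay (s : TakerState) : Measurable (stay s) :=
  measurable_const.max ((measurable_leaveTime s).sub (measurable_enterTime s))

/-- The mean stay in a state during a cycle. -/
noncomputable def meanStay (lam w t : ℝ) : TakerState → ℝ
  | .one_one => w / (1 + lam * w)
  | .two_one => (lam * w / (1 + lam * w)) * (w / (1 + lam * w))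
  | .two_two => (lam * w / (1 + lam * w) ^ 2) * (t / (1 + lam * t))

/-- The mean number of orders in a cycle. -/
noncomputable def meanLength (lam w t : ℝ) : ℝ := ∫ y, (cycleLength y : ℝ) ∂(cycleLaw lam w t)

section
variable {lam w t : ℝ}

open scoped ENNReal in
theorem lintegral_cycleLaw (hl : 0 < lam) (hw : 0 < w) (ht : 0 < t)
    {h : ℝ × ℝ × ℝ × ℝ → ℝ≥0∞} (hh : Measurable h) :
    ∫⁻ y, h y ∂(cycleLaw lam w t) =
      ∫⁻ a, ∫⁻ f, ∫⁻ b, ∫⁻ p, h (a, f, b, p) ∂(expMeasure (1 / t)) ∂(expMeasure lam)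
        ∂(expMeasure (1 / w)) ∂(expMeasure lam) := by
  have := isProbabilityMeasure_expMeasure hl
  have := isProbabilityMeasure_expMeasure (one_div_pos.2 hw)
  have := isProbabilityMeasure_expMeasure (one_div_pos.2 ht)
  rw [cycleLaw, lintegral_prod _ hh.aemeasurable]
  refine lintegral_congr fun a => ?_
  rw [lintegral_prod _ (by fun_prop)]
  refine lintegral_congr fun f => ?_
  rw [lintegral_prod _ (by fun_prop)]

/-- Once the first pickup is known to come later than the next order, the remaining waiting time is
again exponential; likewise for the order after that. The states thus contribute a probability of
being reached times the mean of the minimum of two exponential variables. -/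
theorem lintegral_stay (hl : 0 < lam) (hw : 0 < w) (ht : 0 < t) (s : TakerState) :
    ∫⁻ y, ENNReal.ofReal (stay s y) ∂(cycleLaw lam w t) = ENNReal.ofReal (meanStay lam w t s) := by
  have := isProbabilityMeasure_expMeasure hl
  have hw' := one_div_pos.2 hw
  have ht' := one_div_pos.2 ht
  have := isProbabilityMeasure_expMeasure hw'
  have := isProbabilityMeasure_expMeasure ht'
  rw [lintegral_cycleLaw hl hw ht (measurable_stay s).ennreal_ofReal]
  cases s
  · simp only [stay, enterTime, leaveTime, meanStay, sub_zero, ENNReal.ofReal_max,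
      ENNReal.ofReal_zero, zero_le, sup_of_le_right, lintegral_const, measure_univ, mul_one]
    rw [lintegral_min_expMeasure hl hw']
    congr 1; field_simp; ring
  · have h1 : ∀ a f b p : ℝ, ENNReal.ofReal (stay .two_one (a, f, b, p)) =
        if a < f then ENNReal.ofReal (min b (f - a)) else 0 := fun a f b p => by
      simp only [stay, enterTime, leaveTime]
      split_ifs with h
      · rw [ENNReal.ofReal_max, ENNReal.ofReal_zero, max_eq_right zero_le, ← min_sub_sub_right,
          add_sub_cancel_left]
      · rw [max_eq_left, ENNReal.ofReal_zero]
        linarith [min_le_right (a + b) f]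
    have h2 : ∀ a f : ℝ, ∫⁻ b, (if a < f then ENNReal.ofReal (min b (f - a)) else 0)
        ∂(expMeasure lam) =
        if a < f then ∫⁻ b, ENNReal.ofReal (min b (f - a)) ∂(expMeasure lam) else 0 :=
      fun a f => by split_ifs <;> simp
    simp only [h1, lintegral_const, measure_univ, mul_one, h2]
    rw [lintegral_lintegral_overshoot hl hw'
      (h := fun x => ∫⁻ b, ENNReal.ofReal (min b x) ∂(expMeasure lam))
      (Measurable.lintegral_prod_right' (f := fun z : ℝ × ℝ => ENNReal.ofReal (min z.2 z.1))
        (by fun_prop))]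
    rw [show (fun y : ℝ => ∫⁻ b, ENNReal.ofReal (min b y) ∂(expMeasure lam)) =
      fun y => ∫⁻ b, ENNReal.ofReal (min y b) ∂(expMeasure lam) by simp only [min_comm],
      lintegral_min_expMeasure hw' hl, ← ENNReal.ofReal_mul (by positivity), meanStay]
    congr 1; field_simp; ring
  · have h1 : ∀ a f b p : ℝ, ENNReal.ofReal (stay .two_two (a, f, b, p)) =
        if a < f then ENNReal.ofReal (min (b - (f - a)) p) else 0 := fun a f b p => by
      simp only [stay, enterTime, leaveTime, ← not_lt, ite_not]
      split_ifs with h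
      · rw [ENNReal.ofReal_max, ENNReal.ofReal_zero, max_eq_right zero_le, ← min_sub_sub_right,
          add_sub_cancel_left, sub_sub_eq_add_sub, add_comm a b]
      · simp
    have h2 : ∀ a f : ℝ, ∫⁻ b, ∫⁻ p, (if a < f then ENNReal.ofReal (min (b - (f - a)) p) else 0)
        ∂(expMeasure (1 / t)) ∂(expMeasure lam) =
        if a < f then ∫⁻ b, ∫⁻ p, ENNReal.ofReal (min (b - (f - a)) p)
          ∂(expMeasure (1 / t)) ∂(expMeasure lam) else 0 :=
      fun a f => by split_ifs <;> simp
    have h3 : ∀ x b : ℝ, ∫⁻ p, ENNReal.ofReal (min (b - x) p) ∂(expMeasure (1 / t)) =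
        if x < b then ∫⁻ p, ENNReal.ofReal (min (b - x) p) ∂(expMeasure (1 / t)) else 0 := by
      intro x b
      split_ifs with h
      · rfl
      · refine (lintegral_congr fun p => ?_).trans lintegral_zero
        exact ENNReal.ofReal_of_nonpos ((min_le_left _ _).trans (by linarith))
    have hmeas : Measurable fun x : ℝ => ∫⁻ p, ENNReal.ofReal (min x p) ∂(expMeasure (1 / t)) :=
      Measurable.lintegral_prod_right' (f := fun z : ℝ × ℝ => ENNReal.ofReal (min z.1 z.2))
        (by fun_prop)
    simp only [h1, h2]
    rw [lintegral_lintegral_overshoot hl hw'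
      (h := fun x => ∫⁻ b, ∫⁻ p, ENNReal.ofReal (min (b - x) p)
        ∂(expMeasure (1 / t)) ∂(expMeasure lam))
      (Measurable.lintegral_prod_right' (f := fun z : ℝ × ℝ =>
        ∫⁻ p, ENNReal.ofReal (min (z.2 - z.1) p) ∂(expMeasure (1 / t))) (by fun_prop))]
    rw [lintegral_congr fun x => lintegral_congr (h3 x),
      lintegral_lintegral_overshoot hw' hl hmeas, lintegral_min_expMeasure hl ht',
      ← ENNReal.ofReal_mul (by positivity), ← ENNReal.ofReal_mul (by positivity), meanStay]
    congr 1; field_simp; ring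

/-- Probability that the first pickup takes longer than the next interarrival time. -/
theorem cycleLaw_second_order (hl : 0 < lam) (hw : 0 < w) (ht : 0 < t) :
    cycleLaw lam w t {y | y.1 < y.2.1} = ENNReal.ofReal (lam * w / (1 + lam * w)) := by
  have := isProbabilityMeasure_expMeasure hl
  have hw' := one_div_pos.2 hw
  have ht' := one_div_pos.2 ht
  have := isProbabilityMeasure_expMeasure hw'
  have := isProbabilityMeasure_expMeasure ht'
  have hm : MeasurableSet {y : ℝ × ℝ × ℝ × ℝ | y.1 < y.2.1} :=
    measurableSet_lt (by fun_prop) (by fun_prop)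
  rw [← lintegral_indicator_one hm, lintegral_cycleLaw hl hw ht (measurable_one.indicator hm)]
  have h := lintegral_lintegral_overshoot hl hw' (h := fun _ => 1) measurable_const
  simp only [Set.indicator, Set.mem_ofPred_eq, Pi.one_apply, lintegral_const, measure_univ,
    mul_one] at h ⊢
  rw [h]
  congr 1; field_simp; ring

theorem measurableSet_no_third_order :
    MeasurableSet {y : ℝ × ℝ × ℝ × ℝ | y.1 < y.2.1 ∧ y.2.1 + y.2.2.2 ≤ y.1 + y.2.2.1} := by
  have h1 : MeasurableSet {y : ℝ × ℝ × ℝ × ℝ | y.1 < y.2.1} :=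
    measurableSet_lt (by fun_prop) (by fun_prop)
  have h2 : MeasurableSet {y : ℝ × ℝ × ℝ × ℝ | y.2.1 + y.2.2.2 ≤ y.1 + y.2.2.1} :=
    measurableSet_le (by fun_prop) (by fun_prop)
  exact h1.inter h2

/-- Probability that a courier receives exactly two orders. -/
theorem cycleLaw_no_third_order (hl : 0 < lam) (hw : 0 < w) (ht : 0 < t) :
    cycleLaw lam w t {y | y.1 < y.2.1 ∧ y.2.1 + y.2.2.2 ≤ y.1 + y.2.2.1} =
      ENNReal.ofReal (lam * w / (1 + lam * w) * (1 / (1 + lam * w)) * (1 / (1 + lam * t))) := by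
  have := isProbabilityMeasure_expMeasure hl
  have hw' := one_div_pos.2 hw
  have ht' := one_div_pos.2 ht
  have := isProbabilityMeasure_expMeasure hw'
  have := isProbabilityMeasure_expMeasure ht'
  have hm := measurableSet_no_third_order
  rw [← lintegral_indicator_one hm, lintegral_cycleLaw hl hw ht (measurable_one.indicator hm)]
  have h1 : ∀ a f b p : ℝ,
      Set.indicator {y : ℝ × ℝ × ℝ × ℝ | y.1 < y.2.1 ∧ y.2.1 + y.2.2.2 ≤ y.1 + y.2.2.1} 1
        (a, f, b, p) = if a < f then (Set.Iic (b - (f - a))).indicator (1 : ℝ → ENNReal) p else 0 := by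
    intro a f b p
    simp only [Set.indicator, Set.mem_ofPred_eq, Set.mem_Iic, Pi.one_apply]
    have : f + p ≤ a + b ↔ p ≤ b - (f - a) := by constructor <;> intro h <;> linarith
    split_ifs <;> tauto
  have h2 : ∀ a f : ℝ, ∫⁻ b, ∫⁻ p, (if a < f then
        (Set.Iic (b - (f - a))).indicator (1 : ℝ → ENNReal) p else 0)
        ∂(expMeasure (1 / t)) ∂(expMeasure lam) =
        if a < f then ∫⁻ b, expMeasure (1 / t) (Set.Iic (b - (f - a))) ∂(expMeasure lam) else 0 :=
    fun a f => by split_ifs <;> simp [lintegral_indicator_one measurableSet_Iic]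
  have h3 : ∀ x b : ℝ, expMeasure (1 / t) (Set.Iic (b - x)) =
      if x < b then expMeasure (1 / t) (Set.Iic (b - x)) else 0 := by
    intro x b
    split_ifs with h
    · rfl
    · refine measure_mono_null (fun p hp => ?_) (expMeasure_ae_pos (1 / t))
      have : p ≤ b - x := hp
      simp only [Set.mem_compl_iff, Set.mem_ofPred_eq, not_lt]
      linarith
  have hmeas : Measurable fun x : ℝ => expMeasure (1 / t) (Set.Iic x) :=
    Monotone.measurable fun x y h => measure_mono (Set.Iic_subset_Iic.2 h)
  simp only [h1, h2]
  rw [lintegral_lintegral_overshoot hl hw'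
    (h := fun x => ∫⁻ b, expMeasure (1 / t) (Set.Iic (b - x)) ∂(expMeasure lam))
    (Measurable.lintegral_prod_right' (f := fun z : ℝ × ℝ =>
      expMeasure (1 / t) (Set.Iic (z.2 - z.1)))
      (hmeas.comp (measurable_snd.sub measurable_fst)))]
  rw [lintegral_congr fun x => lintegral_congr (h3 x), lintegral_lintegral_overshoot hw' hl hmeas]
  have h4 : ∫⁻ b, expMeasure (1 / t) (Set.Iic b) ∂(expMeasure lam) =
      ENNReal.ofReal (1 - lam / (lam + 1 / t)) := by
    have h5 : ∀ b, expMeasure (1 / t) (Set.Iic b) = 1 - expMeasure (1 / t) (Set.Ioi b) := fun b => by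
      rw [← Set.compl_Ioi, prob_compl_eq_one_sub measurableSet_Ioi]
    have h6 := lintegral_lintegral_overshoot hl ht' (h := fun _ => 1) measurable_const
    have h7 : ∀ b : ℝ, ∫⁻ p, (if b < p then (1 : ENNReal) else 0) ∂(expMeasure (1 / t)) =
        expMeasure (1 / t) (Set.Ioi b) := fun b => by
      rw [← lintegral_indicator_one measurableSet_Ioi]; rfl
    simp only [h7, lintegral_const, measure_univ, mul_one] at h6
    simp only [h5]
    rw [lintegral_sub (Antitone.measurable fun x y h => measure_mono (Set.Ioi_subset_Ioi h))
      (by rw [h6]; exact ENNReal.ofReal_ne_top) (Eventually.of_forall fun _ => prob_le_one), h6,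
      lintegral_const, measure_univ, mul_one, ENNReal.ofReal_sub _ (by positivity),
      ENNReal.ofReal_one]
  rw [h4, ← ENNReal.ofReal_mul (by positivity), ← ENNReal.ofReal_mul (by positivity)]
  congr 1; field_simp; ring

theorem isProbabilityMeasure_cycleLaw (hl : 0 < lam) (hw : 0 < w) (ht : 0 < t) :
    IsProbabilityMeasure (cycleLaw lam w t) := by
  have := isProbabilityMeasure_expMeasure hl
  have := isProbabilityMeasure_expMeasure (one_div_pos.2 hw)
  have := isProbabilityMeasure_expMeasure (one_div_pos.2 ht)
  unfold cycleLaw; infer_instance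

/-- The mean number of orders matched during a cycle is `lam` times the mean time during which
there is a taker: Poisson arrivals see time averages. -/
theorem meanLength_eq (hl : 0 < lam) (hw : 0 < w) (ht : 0 < t) :
    meanLength lam w t = 1 + lam *
      (meanStay lam w t .one_one + meanStay lam w t .two_one + meanStay lam w t .two_two) := by
  have := isProbabilityMeasure_cycleLaw hl hw ht
  have hm1 : MeasurableSet {y : ℝ × ℝ × ℝ × ℝ | y.1 < y.2.1} :=
    measurableSet_lt (by fun_prop) (by fun_prop)
  have hm2 := measurableSet_no_third_order
  have h1 : ∀ y : ℝ × ℝ × ℝ × ℝ, (cycleLength y : ℝ) =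
      1 + 2 * Set.indicator {y : ℝ × ℝ × ℝ × ℝ | y.1 < y.2.1} (1 : ℝ × ℝ × ℝ × ℝ → ℝ) y -
      Set.indicator {y : ℝ × ℝ × ℝ × ℝ | y.1 < y.2.1 ∧ y.2.1 + y.2.2.2 ≤ y.1 + y.2.2.1}
        (1 : ℝ × ℝ × ℝ × ℝ → ℝ) y := by
    intro y
    simp only [cycleLength, Set.indicator, Set.mem_ofPred_eq, Pi.one_apply, ← not_lt]
    split_ifs <;> first | (norm_num; done) | tauto
  simp only [meanLength, h1]
  have i1 : Integrable (Set.indicator {y : ℝ × ℝ × ℝ × ℝ | y.1 < y.2.1} (1 : ℝ × ℝ × ℝ × ℝ → ℝ))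
    (cycleLaw lam w t) := (integrable_const (1 : ℝ)).indicator hm1
  have i2 : Integrable (Set.indicator {y : ℝ × ℝ × ℝ × ℝ | y.1 < y.2.1 ∧
    y.2.1 + y.2.2.2 ≤ y.1 + y.2.2.1} (1 : ℝ × ℝ × ℝ × ℝ → ℝ))
    (cycleLaw lam w t) := (integrable_const (1 : ℝ)).indicator hm2
  have i3 : Integrable (fun y : ℝ × ℝ × ℝ × ℝ => 1 + 2 * Set.indicator
    {y : ℝ × ℝ × ℝ × ℝ | y.1 < y.2.1} (1 : ℝ × ℝ × ℝ × ℝ → ℝ) y) (cycleLaw lam w t) :=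
    (integrable_const 1).add (i1.const_mul 2)
  rw [integral_sub i3 i2, integral_add (integrable_const 1) (i1.const_mul 2), integral_const_mul,
    integral_indicator_one hm1, integral_indicator_one hm2, measureReal_def, measureReal_def,
    cycleLaw_second_order hl hw ht, cycleLaw_no_third_order hl hw ht,
    ENNReal.toReal_ofReal (by positivity), ENNReal.toReal_ofReal (by positivity)]
  simp only [integral_const, probReal_univ, smul_eq_mul, meanStay]
  field_simp
  ring

end

/-! ### Independence of the cycles and the law of large numbers -/

section
variable {Ω : Type*} {mΩ : MeasurableSpace Ω} {μ : Measure Ω} {X : Ω → Realization}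

/-- The random times of the model as one family. -/
def times (X : Ω → Realization) : ℕ ⊕ ℕ ⊕ ℕ → Ω → ℝ :=
  Sum.elim (fun (k : ℕ) ω => (X ω).interarrival k)
    (Sum.elim (fun (k : ℕ) ω => (X ω).firstPickup k) (fun (k : ℕ) ω => (X ω).secondPickup k))

/-- The σ-algebra generated by the times with indices in `S`. -/
abbrev sigmaOf (X : Ω → Realization) (S : Set (ℕ ⊕ ℕ ⊕ ℕ)) : MeasurableSpace Ω :=
  ⨆ i ∈ S, MeasurableSpace.comap (times X i) inferInstance

theorem measurable_times {S : Set (ℕ ⊕ ℕ ⊕ ℕ)} {i : ℕ ⊕ ℕ ⊕ ℕ} (hi : i ∈ S) :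
    Measurable[sigmaOf X S] (times X i) :=
  (comap_measurable (times X i)).mono
    (le_iSup₂ (f := fun i (_ : i ∈ S) => MeasurableSpace.comap (times X i) inferInstance) i hi) le_rfl

theorem sigmaOf_mono {S T : Set (ℕ ⊕ ℕ ⊕ ℕ)} (h : S ⊆ T) : sigmaOf X S ≤ sigmaOf X T :=
  biSup_mono h

theorem sigmaOf_le (hX : ∀ i, Measurable (times X i)) (S : Set (ℕ ⊕ ℕ ⊕ ℕ)) :
    sigmaOf X S ≤ mΩ :=
  iSup₂_le fun i _ => (hX i).comap_le

theorem indep_sigmaOf (hX : ∀ i, Measurable (times X i)) (hind : iIndepFun (times X) μ)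
    {S T : Set (ℕ ⊕ ℕ ⊕ ℕ)} (h : Disjoint S T) : Indep (sigmaOf X S) (sigmaOf X T) μ :=
  indep_iSup_of_disjoint (fun i => (hX i).comap_le) hind h

/-- The interarrival times up to the arrival of order `k` and the pickup times of the couriers with
smaller numbers. -/
def pastIndex (k : ℕ) : Set (ℕ ⊕ ℕ ⊕ ℕ) :=
  {i | Sum.elim (fun j => j ≤ k) (Sum.elim (fun j => j < k) (fun j => j < k)) i}

/-- The times that determine the cycle beginning with order `k`. -/
def cycleIndex (k : ℕ) : Set (ℕ ⊕ ℕ ⊕ ℕ) :=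
  {.inl (k + 1), .inr (.inl k), .inl (k + 2), .inr (.inr k)}

theorem pastIndex_mono : Monotone pastIndex := by
  intro k l hkl i hi
  rcases i with i | i | i <;> simp only [pastIndex, Set.mem_ofPred_eq, Sum.elim_inl, Sum.elim_inr]
    at hi ⊢ <;> omega

theorem disjoint_past_cycle (k : ℕ) : Disjoint (pastIndex k) (cycleIndex k) := by
  rw [Set.disjoint_left]
  intro i hi hc
  simp only [cycleIndex, Set.mem_insert_iff, Set.mem_singleton_iff] at hc
  rcases hc with rfl | rfl | rfl | rfl <;> simp [pastIndex] at hi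

theorem cycleIndex_subset {j k : ℕ} (h : j + 2 ≤ k) : cycleIndex j ⊆ pastIndex k := by
  intro i hi
  simp only [cycleIndex, Set.mem_insert_iff, Set.mem_singleton_iff] at hi
  rcases hi with rfl | rfl | rfl | rfl <;> simp [pastIndex] <;> omega

theorem measurable_cycleData {S : Set (ℕ ⊕ ℕ ⊕ ℕ)} {k : ℕ} (h : cycleIndex k ⊆ S) :
    Measurable[sigmaOf X S] fun ω => (X ω).cycleData k := by
  have m1 : Measurable[sigmaOf X S] (times X (.inl (k + 1))) :=
    measurable_times (h (by simp [cycleIndex]))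
  have m2 : Measurable[sigmaOf X S] (times X (.inr (.inl k))) :=
    measurable_times (h (by simp [cycleIndex]))
  have m3 : Measurable[sigmaOf X S] (times X (.inl (k + 2))) :=
    measurable_times (h (by simp [cycleIndex]))
  have m4 : Measurable[sigmaOf X S] (times X (.inr (.inr k))) :=
    measurable_times (h (by simp [cycleIndex]))
  exact m1.prodMk (m2.prodMk (m3.prodMk m4))

theorem hasLaw_prodMk_of_disjoint (hX : ∀ i, Measurable (times X i)) (hind : iIndepFun (times X) μ)
    [IsProbabilityMeasure μ] {α β : Type*} [MeasurableSpace α] [MeasurableSpace β]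
    {S T : Set (ℕ ⊕ ℕ ⊕ ℕ)} (h : Disjoint S T) {f : Ω → α} {g : Ω → β}
    (hf : Measurable[sigmaOf X S] f) (hg : Measurable[sigmaOf X T] g) {ν : Measure α}
    {ρ : Measure β} (hν : HasLaw f ν μ) (hρ : HasLaw g ρ μ) :
    HasLaw (fun ω => (f ω, g ω)) (ν.prod ρ) μ := by
  have hfg : IndepFun f g μ :=
    indep_of_indep_of_le_left (indep_of_indep_of_le_right (indep_sigmaOf hX hind h) hg.comap_le)
      hf.comap_le
  refine ⟨hν.aemeasurable.prodMk hρ.aemeasurable, ?_⟩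
  rw [(indepFun_iff_map_prod_eq_prod_map_map hν.aemeasurable hρ.aemeasurable).1 hfg, hν.map_eq,
    hρ.map_eq]

theorem hasLaw_cycleData [IsProbabilityMeasure μ] {lam w t : ℝ} (hM : IsMatchingModel μ lam w t X)
    (hX : ∀ i, Measurable (times X i)) (k : ℕ) :
    HasLaw (fun ω => (X ω).cycleData k) (cycleLaw lam w t) μ := by
  have hind : iIndepFun (times X) μ := hM.independent
  have m1 : Measurable[sigmaOf X {.inl (k + 1)}] fun ω => (X ω).interarrival (k + 1) :=
    measurable_times (i := .inl (k + 1)) rfl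
  have m2 : Measurable[sigmaOf X {.inr (.inl k)}] fun ω => (X ω).firstPickup k :=
    measurable_times (i := .inr (.inl k)) rfl
  have m3 : Measurable[sigmaOf X {.inl (k + 2)}] fun ω => (X ω).interarrival (k + 2) :=
    measurable_times (i := .inl (k + 2)) rfl
  have m4 : Measurable[sigmaOf X {.inr (.inr k)}] fun ω => (X ω).secondPickup k :=
    measurable_times (i := .inr (.inr k)) rfl
  have m34 : Measurable[sigmaOf X {.inl (k + 2), .inr (.inr k)}]
      fun ω => ((X ω).interarrival (k + 2), (X ω).secondPickup k) :=
    (m3.mono (sigmaOf_mono (by simp)) le_rfl).prodMk (m4.mono (sigmaOf_mono (by simp)) le_rfl)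
  have m234 : Measurable[sigmaOf X {.inr (.inl k), .inl (k + 2), .inr (.inr k)}]
      fun ω => ((X ω).firstPickup k, (X ω).interarrival (k + 2), (X ω).secondPickup k) :=
    (m2.mono (sigmaOf_mono (by simp)) le_rfl).prodMk (m34.mono (sigmaOf_mono (by simp)) le_rfl)
  exact hasLaw_prodMk_of_disjoint hX hind (by simp) m1 m234 (hM.interarrival_law _)
    (hasLaw_prodMk_of_disjoint hX hind (by simp) m2 m34 (hM.firstPickup_law _)
      (hasLaw_prodMk_of_disjoint hX hind (by simp) m3 m4 (hM.interarrival_law _)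
        (hM.secondPickup_law _)))

/-- The data of the `n`-th cycle. -/
noncomputable def cycle (X : Ω → Realization) (n : ℕ) (ω : Ω) : ℝ × ℝ × ℝ × ℝ :=
  (X ω).cycleData ((X ω).cycleStart n)

/-- The event `B` is determined by what is known at the beginning of the `n`-th cycle: on the event
that this cycle begins with order `k`, it is determined by the past of order `k`. -/
def DeterminedBefore (X : Ω → Realization) (n : ℕ) (B : Set Ω) : Prop :=
  ∀ k, MeasurableSet[sigmaOf X (pastIndex k)] (B ∩ {ω | (X ω).cycleStart n = k})

/-- A function of the cycle data that can be evaluated by the end of the cycle: if the cycle consists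
of a single order, then it does not depend on the last two entries. -/
def KnownAtEnd {α : Type*} (g : ℝ × ℝ × ℝ × ℝ → α) : Prop :=
  ∀ a f b p b' p', f ≤ a → g (a, f, b, p) = g (a, f, b', p')

theorem eq_iUnion_cycleStart (n : ℕ) (B : Set Ω) :
    B = ⋃ k, B ∩ {ω | (X ω).cycleStart n = k} := by
  ext ω; simp

theorem DeterminedBefore.measurableSet (hX : ∀ i, Measurable (times X i)) {n : ℕ} {B : Set Ω}
    (hB : DeterminedBefore X n B) : MeasurableSet B := by
  rw [eq_iUnion_cycleStart (X := X) n B]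
  exact MeasurableSet.iUnion fun k => sigmaOf_le hX _ _ (hB k)

theorem determinedBefore_zero : DeterminedBefore X 0 Set.univ := by
  intro k
  by_cases h : 0 = k
  · simp [Realization.cycleStart, h]
  · simp [Realization.cycleStart, h]

/-- Knowledge accumulates: what was known at the beginning of a cycle, and what the cycle reveals by
its end, are known at the beginning of the next one. -/
theorem DeterminedBefore.inter {α : Type*} [MeasurableSpace α] {g : ℝ × ℝ × ℝ × ℝ → α}
    (hg : Measurable g) (hg' : KnownAtEnd g) {n : ℕ} {B : Set Ω} (hB : DeterminedBefore X n B)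
    {A : Set α} (hA : MeasurableSet A) :
    DeterminedBefore X (n + 1) (B ∩ {ω | g (cycle X n ω) ∈ A}) := by
  intro k
  have h1 : (B ∩ {ω | g (cycle X n ω) ∈ A}) ∩ {ω | (X ω).cycleStart (n + 1) = k} =
      ⋃ j, ⋃ _ : j < k, (B ∩ {ω | (X ω).cycleStart n = j}) ∩
        {ω | g ((X ω).cycleData j) ∈ A ∧ j + cycleLength ((X ω).cycleData j) = k} := by
    ext ω
    simp only [cycle, Realization.cycleStart, Set.mem_inter_iff, Set.mem_ofPred_eq, Set.mem_iUnion]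
    constructor
    · rintro ⟨⟨h1, h2⟩, h3⟩
      have := cycleLength_pos ((X ω).cycleData ((X ω).cycleStart n))
      exact ⟨_, by omega, ⟨h1, rfl⟩, h2, h3⟩
    · rintro ⟨j, -, ⟨h1, rfl⟩, h2, h3⟩
      exact ⟨⟨h1, h2⟩, h3⟩
  rw [h1]
  refine MeasurableSet.iUnion fun j => MeasurableSet.iUnion fun hjk => MeasurableSet.inter
    (sigmaOf_mono (pastIndex_mono hjk.le) _ (hB j)) ?_
  -- a cycle of two or three orders reveals all four entries of its data; one of a single order
  -- reveals only the first two
  rcases Nat.lt_or_ge (j + 1) k with hk | hk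
  · have m : Measurable[sigmaOf X (pastIndex k)] fun ω => (X ω).cycleData j :=
      measurable_cycleData (cycleIndex_subset hk)
    have m1 := m (hg hA)
    have m2 := m (measurable_cycleLength (measurableSet_singleton (k - j)))
    convert m1.inter m2 using 1
    ext ω
    simp only [Set.mem_ofPred_eq, Set.mem_inter_iff, Set.mem_preimage, Set.mem_singleton_iff]
    exact and_congr_right fun _ => by omega
  · obtain rfl : k = j + 1 := by omega
    have ma : Measurable[sigmaOf X (pastIndex (j + 1))] fun ω => (X ω).interarrival (j + 1) :=
      measurable_times (i := .inl (j + 1)) (by simp [pastIndex])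
    have mf : Measurable[sigmaOf X (pastIndex (j + 1))] fun ω => (X ω).firstPickup j :=
      measurable_times (i := .inr (.inl j)) (by simp [pastIndex])
    have m : Measurable[sigmaOf X (pastIndex (j + 1))] fun ω =>
        ((X ω).interarrival (j + 1), (X ω).firstPickup j, (0 : ℝ), (0 : ℝ)) :=
      ma.prodMk (mf.prodMk measurable_const)
    have m1 := m (hg hA)
    have m2 : MeasurableSet[sigmaOf X (pastIndex (j + 1))]
      {ω | (X ω).firstPickup j ≤ (X ω).interarrival (j + 1)} := measurableSet_le mf ma
    convert m1.inter m2 using 1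
    ext ω
    simp only [Set.mem_ofPred_eq, Set.mem_inter_iff, Set.mem_preimage, add_right_inj,
      cycleLength_eq_one_iff, Realization.cycleData]
    exact and_congr_left fun h => by rw [hg' _ _ _ _ 0 0 h]

theorem determinedBefore_univ (n : ℕ) : DeterminedBefore X n Set.univ := by
  induction n with
  | zero => exact determinedBefore_zero
  | succ n ih =>
    simpa using ih.inter (g := fun _ => ()) measurable_const (fun _ _ _ _ _ _ _ => rfl)
      MeasurableSet.univ

/-- What happened in an earlier cycle is known at the beginning of a later one. -/
theorem determinedBefore_of_lt {g : ℝ × ℝ × ℝ × ℝ → ℝ} (hg : Measurable g) (hg' : KnownAtEnd g)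
    {A : Set ℝ} (hA : MeasurableSet A) {m n : ℕ} (hmn : m < n) :
    DeterminedBefore X n {ω | g (cycle X m ω) ∈ A} := by
  induction n, hmn using Nat.le_induction with
  | base => simpa using (determinedBefore_univ m).inter hg hg' hA
  | succ n _ ih =>
    simpa using ih.inter (g := fun _ => ()) measurable_const (fun _ _ _ _ _ _ _ => rfl)
      MeasurableSet.univ

theorem measurable_comp_cycle (hX : ∀ i, Measurable (times X i)) {g : ℝ × ℝ × ℝ × ℝ → ℝ}
    (hg : Measurable g) (hg' : KnownAtEnd g) (n : ℕ) : Measurable fun ω => g (cycle X n ω) := fun _ hA =>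
  (determinedBefore_of_lt hg hg' hA (Nat.lt_succ_self n)).measurableSet hX

theorem measurableSet_cycleStart (hX : ∀ i, Measurable (times X i)) (n k : ℕ) :
    MeasurableSet {ω | (X ω).cycleStart n = k} := by
  have h := sigmaOf_le hX _ _ (determinedBefore_univ n k)
  rwa [Set.univ_inter] at h

section
variable [IsProbabilityMeasure μ] {lam w t : ℝ}
  (hM : IsMatchingModel μ lam w t X) (hX : ∀ i, Measurable (times X i))
include hM hX

/-- Each cycle is independent of what is known at its beginning, and has the law of the first one. -/
theorem measure_inter_cycle {n : ℕ} {B : Set Ω} (hB : DeterminedBefore X n B)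
    {A : Set (ℝ × ℝ × ℝ × ℝ)} (hA : MeasurableSet A) :
    μ (B ∩ {ω | cycle X n ω ∈ A}) = μ B * cycleLaw lam w t A := by
  have hm : ∀ k, MeasurableSet (B ∩ {ω | (X ω).cycleStart n = k}) := fun k =>
    sigmaOf_le hX _ _ (hB k)
  have hmd : ∀ k, Measurable fun ω => (X ω).cycleData k := fun k =>
    (measurable_cycleData (S := Set.univ) (Set.subset_univ _)).mono (sigmaOf_le hX _) le_rfl
  have hdisj : Pairwise (Function.onFun Disjoint fun k => B ∩ {ω | (X ω).cycleStart n = k}) := by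
    intro j k hjk
    refine Set.disjoint_left.2 fun ω h1 h2 => hjk (h1.2.symm.trans h2.2)
  have h1 : B ∩ {ω | cycle X n ω ∈ A} =
      ⋃ k, (B ∩ {ω | (X ω).cycleStart n = k}) ∩ (fun ω => (X ω).cycleData k) ⁻¹' A := by
    ext ω; simp [cycle, and_comm]
  have h2 : ∀ k, μ ((B ∩ {ω | (X ω).cycleStart n = k}) ∩ (fun ω => (X ω).cycleData k) ⁻¹' A) =
      μ (B ∩ {ω | (X ω).cycleStart n = k}) * cycleLaw lam w t A := by
    intro k
    rw [(Indep_iff _ _ _).1 (indep_sigmaOf hX hM.independent (disjoint_past_cycle k)) _ _ (hB k)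
      (measurable_cycleData le_rfl hA), ← (hasLaw_cycleData hM hX k).map_eq,
      Measure.map_apply (hmd k) hA]
  rw [h1, measure_iUnion (fun j k hjk => (hdisj hjk).mono Set.inter_subset_left
    Set.inter_subset_left) fun k => (hm k).inter (hmd k hA)]
  simp only [h2]
  rw [ENNReal.tsum_mul_right, ← measure_iUnion hdisj hm, ← eq_iUnion_cycleStart]

theorem hasLaw_comp_cycle {g : ℝ × ℝ × ℝ × ℝ → ℝ} (hg : Measurable g) (hg' : KnownAtEnd g)
    (n : ℕ) : HasLaw (fun ω => g (cycle X n ω)) ((cycleLaw lam w t).map g) μ := by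
  have hm := measurable_comp_cycle hX hg hg' n
  refine ⟨hm.aemeasurable, Measure.ext fun A hA => ?_⟩
  rw [Measure.map_apply hm hA, Measure.map_apply hg hA]
  have h := measure_inter_cycle hM hX (determinedBefore_univ n) (hg hA)
  rw [Set.univ_inter, measure_univ, one_mul] at h
  exact h

theorem indepFun_comp_cycle {g : ℝ × ℝ × ℝ × ℝ → ℝ} (hg : Measurable g) (hg' : KnownAtEnd g)
    {m n : ℕ} (hmn : m < n) :
    IndepFun (fun ω => g (cycle X m ω)) (fun ω => g (cycle X n ω)) μ := by
  rw [indepFun_iff_measure_inter_preimage_eq_mul]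
  intro A A' hA hA'
  have h := measure_inter_cycle hM hX (determinedBefore_of_lt hg hg' hA hmn) (hg hA')
  rw [← Measure.map_apply hg hA', ← (hasLaw_comp_cycle hM hX hg hg' n).map_eq,
    Measure.map_apply (measurable_comp_cycle hX hg hg' n) hA'] at h
  exact h

/-- The law of large numbers for the cycles. -/
theorem tendsto_cycle_average {g : ℝ × ℝ × ℝ × ℝ → ℝ} (hg : Measurable g) (hg' : KnownAtEnd g)
    (hint : Integrable g (cycleLaw lam w t)) :
    ∀ᵐ ω ∂μ, Tendsto (fun n : ℕ => (∑ m ∈ Finset.range n, g (cycle X m ω)) / n) atTop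
      (𝓝 (∫ y, g y ∂(cycleLaw lam w t))) := by
  have hm := measurable_comp_cycle hX hg hg'
  have hlaw := hasLaw_comp_cycle hM hX hg hg'
  have hid : Integrable id ((cycleLaw lam w t).map g) :=
    (integrable_map_measure aestronglyMeasurable_id hg.aemeasurable).2 hint
  have h := strong_law_ae_real (μ := μ) (fun n ω => g (cycle X n ω)) ?_ ?_ ?_
  · have h0 : ∫ ω, g (cycle X 0 ω) ∂μ = ∫ y, g y ∂(cycleLaw lam w t) := by
      have h1 := integral_map (μ := μ) (hm 0).aemeasurable (f := id) aestronglyMeasurable_id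
      rw [(hlaw 0).map_eq, integral_map hg.aemeasurable aestronglyMeasurable_id] at h1
      exact h1.symm
    rwa [h0] at h
  · rw [← (hlaw 0).map_eq] at hid
    exact (integrable_map_measure aestronglyMeasurable_id (hm 0).aemeasurable).1 hid
  · intro m n hmn
    rcases lt_or_gt_of_ne hmn with h | h
    · exact indepFun_comp_cycle hM hX hg hg' h
    · exact (indepFun_comp_cycle hM hX hg hg' h).symm
  · exact fun n => ⟨(hm n).aemeasurable, (hm 0).aemeasurable,
      (hlaw n).map_eq.trans (hlaw 0).map_eq.symm⟩

end
end

/-! ### Almost sure limits -/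

theorem stay_eq_zero {s : TakerState} (hs : s ≠ .one_one) {y : ℝ × ℝ × ℝ × ℝ} (h : y.2.1 ≤ y.1) :
    stay s y = 0 := by
  cases s
  · exact absurd rfl hs
  · refine max_eq_left ?_
    simp only [leaveTime, enterTime]
    linarith [min_le_right (y.1 + y.2.2.1) y.2.1]
  · simp [stay, leaveTime, enterTime, h]

theorem knownAtEnd_stay (s : TakerState) : KnownAtEnd (stay s) := by
  intro a f b p b' p' h
  by_cases hs : s = .one_one
  · subst hs; rfl
  · rw [stay_eq_zero hs h, stay_eq_zero hs h]

theorem knownAtEnd_cycleLength : KnownAtEnd fun y => (cycleLength y : ℝ) := by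
  intro a f b p b' p' h
  simp [cycleLength, h]

theorem measurableSet_stay_pos (s : TakerState) : MeasurableSet {y | 0 < stay s y} :=
  measurableSet_lt measurable_const (measurable_stay s)

section
variable {lam w t : ℝ} (hl : 0 < lam) (hw : 0 < w) (ht : 0 < t)
include hl hw ht

theorem meanStay_pos (s : TakerState) : 0 < meanStay lam w t s := by
  cases s <;> unfold meanStay <;> positivity

theorem integrable_stay (s : TakerState) : Integrable (stay s) (cycleLaw lam w t) := by
  refine ⟨(measurable_stay s).aestronglyMeasurable, ?_⟩
  rw [hasFiniteIntegral_iff_ofReal (Eventually.of_forall (stay_nonneg s)),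
    lintegral_stay hl hw ht]
  exact ENNReal.ofReal_lt_top

theorem integral_stay (s : TakerState) :
    ∫ y, stay s y ∂(cycleLaw lam w t) = meanStay lam w t s := by
  rw [integral_eq_lintegral_of_nonneg_ae (Eventually.of_forall (stay_nonneg s))
    (measurable_stay s).aestronglyMeasurable, lintegral_stay hl hw ht,
    ENNReal.toReal_ofReal (meanStay_pos hl hw ht s).le]

/-- A state is visited with positive probability, since the mean stay in it is positive. -/
theorem visit_ne_zero (s : TakerState) : (cycleLaw lam w t).real {y | 0 < stay s y} ≠ 0 := by
  have := isProbabilityMeasure_cycleLaw hl hw ht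
  intro h
  rw [measureReal_eq_zero_iff] at h
  have h1 : stay s =ᵐ[cycleLaw lam w t] 0 := by
    have h2 : ∀ᵐ y ∂(cycleLaw lam w t), ¬ 0 < stay s y := measure_eq_zero_iff_ae_notMem.1 h
    filter_upwards [h2] with y hy
    exact le_antisymm (not_lt.1 hy) (stay_nonneg s y)
  have h3 := integral_stay hl hw ht s
  rw [integral_congr_ae h1] at h3
  simp only [Pi.zero_apply, integral_zero] at h3
  exact (meanStay_pos hl hw ht s).ne h3

end

theorem Realization.cycleStart_eq_sum (R : Realization) (n : ℕ) :
    R.cycleStart n = ∑ m ∈ Finset.range n, cycleLength (R.cycleData (R.cycleStart m)) := by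
  induction n with
  | zero => rfl
  | succ n ih => rw [Finset.sum_range_succ, ← ih]; rfl

section
variable {Ω : Type*} {mΩ : MeasurableSpace Ω} {μ : Measure Ω}
  {X : Ω → Realization} {lam w t : ℝ} (hM : IsMatchingModel μ lam w t X)

include hM in
theorem ae_regular (hA : ∀ᵐ ω ∂μ, (X ω).NoSimultaneousArrivals) : ∀ᵐ ω ∂μ, (X ω).Regular := by
  have h1 : ∀ᵐ ω ∂μ, ∀ k, 0 < (X ω).secondPickup k := ae_all_iff.2 fun k =>
    ((hM.secondPickup_law k).ae_iff (p := fun x => 0 < x) (by fun_prop)).2 (expMeasure_ae_pos _)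
  have h2 : ∀ᵐ ω ∂μ, 0 < (X ω).interarrival 0 :=
    ((hM.interarrival_law 0).ae_iff (p := fun x => 0 < x) (by fun_prop)).2 (expMeasure_ae_pos _)
  filter_upwards [hA, hM.takersFirst, h1, h2] with ω hA hT h1 h2
  exact ⟨hA, hT, h1, by simpa [Realization.arrival] using h2.le⟩

include hM in
/-- There is a version of the model in which all times are measurable functions, and not only almost
everywhere equal to measurable ones. -/
theorem exists_measurable_version :
    ∃ X' : Ω → Realization, X =ᵐ[μ] X' ∧ IsMatchingModel μ lam w t X' ∧
      ∀ i, Measurable (times X' i) := by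
  have ha : ∀ i, AEMeasurable (times X i) μ := by
    rintro (k | k | k)
    · exact (hM.interarrival_law k).aemeasurable
    · exact (hM.firstPickup_law k).aemeasurable
    · exact (hM.secondPickup_law k).aemeasurable
  let X' : Ω → Realization := fun ω =>
    ⟨fun k => (ha (.inl k)).mk _ ω, fun k => (ha (.inr (.inl k))).mk _ ω,
      fun k => (ha (.inr (.inr k))).mk _ ω, (X ω).partner⟩
  have hX' : ∀ i, times X' i = (ha i).mk _ := by rintro (k | k | k) <;> rfl
  have hae : ∀ i, times X i =ᵐ[μ] times X' i := fun i => by rw [hX']; exact (ha i).ae_eq_mk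
  have heq : X =ᵐ[μ] X' := by
    filter_upwards [ae_all_iff.2 hae] with ω h
    have e1 : (X ω).interarrival = (X' ω).interarrival := funext fun k => h (.inl k)
    have e2 : (X ω).firstPickup = (X' ω).firstPickup := funext fun k => h (.inr (.inl k))
    have e3 : (X ω).secondPickup = (X' ω).secondPickup := funext fun k => h (.inr (.inr k))
    have e4 : (X ω).partner = (X' ω).partner := rfl
    cases hx : X ω
    cases hy : X' ω
    simp_all
  refine ⟨X', heq, ⟨fun k => (hM.interarrival_law k).congr (hae (.inl k)).symm,
    fun k => (hM.firstPickup_law k).congr (hae (.inr (.inl k))).symm,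
    fun k => (hM.secondPickup_law k).congr (hae (.inr (.inr k))).symm, ?_, ?_⟩, ?_⟩
  · exact (iIndepFun_congr hae).1 hM.independent
  · filter_upwards [hM.takersFirst, heq] with ω h e
    exact e ▸ h
  · intro i
    rw [hX']
    exact (ha i).measurable_mk

include hM in
theorem tendsto_arrival (hl : 0 < lam) :
    ∀ᵐ ω ∂μ, Tendsto (fun n : ℕ => (X ω).arrival n / n) atTop (𝓝 (1 / lam)) := by
  have hint : Integrable id (expMeasure lam) := by
    refine ⟨aestronglyMeasurable_id, ?_⟩
    rw [hasFiniteIntegral_iff_ofReal (f := id) ((expMeasure_ae_pos lam).mono fun _ h => h.le)]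
    simp only [id, lintegral_id_expMeasure hl, ENNReal.ofReal_lt_top]
  have hmean : ∫ x, x ∂(expMeasure lam) = 1 / lam := by
    rw [integral_eq_lintegral_of_nonneg_ae ((expMeasure_ae_pos lam).mono fun _ h => h.le)
      aestronglyMeasurable_id, lintegral_id_expMeasure hl, ENNReal.toReal_ofReal (by positivity)]
  have hlaw := hM.interarrival_law
  have h := strong_law_ae_real (μ := μ) (fun n ω => (X ω).interarrival n) ?_ ?_ ?_
  · have h0 : ∫ ω, (X ω).interarrival 0 ∂μ = 1 / lam := by
      have h1 := integral_map (μ := μ) (hlaw 0).aemeasurable (f := id) aestronglyMeasurable_id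
      rw [(hlaw 0).map_eq] at h1
      exact h1.symm.trans hmean
    rw [h0] at h
    filter_upwards [h] with ω hω
    have h2 := (hω.comp (tendsto_add_atTop_nat 1)).mul
      ((tendsto_natCast_div_add_atTop (𝕜 := ℝ) (1 : ℝ)).inv₀ one_ne_zero)
    rw [inv_one, mul_one] at h2
    refine h2.congr' ?_
    filter_upwards [eventually_ne_atTop 0] with n hn
    have : (n : ℝ) ≠ 0 := by exact_mod_cast hn
    have : (n : ℝ) + 1 ≠ 0 := by positivity
    simp only [Function.comp, Realization.arrival]
    push_cast
    field_simp
  · have hi := (hlaw 0).map_eq ▸ hint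
    exact (integrable_map_measure aestronglyMeasurable_id (hlaw 0).aemeasurable).1 hi
  · intro m n hmn
    exact hM.independent.indepFun (i := .inl m) (j := .inl n) (by simpa using hmn)
  · exact fun n => ⟨(hlaw n).aemeasurable, (hlaw 0).aemeasurable,
      (hlaw n).map_eq.trans (hlaw 0).map_eq.symm⟩

theorem meanLength_pos (hl : 0 < lam) (hw : 0 < w) (ht : 0 < t) : 0 < meanLength lam w t := by
  rw [meanLength_eq hl hw ht]
  have := meanStay_pos hl hw ht
  have h1 := this .one_one
  have h2 := this .two_one
  have h3 := this .two_two
  positivity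

variable [IsProbabilityMeasure μ]

include hM in
/-- The number of orders in the first `n` cycles is a sum of cycle rewards. -/
theorem tendsto_cycleStart (hX : ∀ i, Measurable (times X i)) (hl : 0 < lam) (hw : 0 < w)
    (ht : 0 < t) : ∀ᵐ ω ∂μ,
      Tendsto (fun n : ℕ => ((X ω).cycleStart n : ℝ) / n) atTop (𝓝 (meanLength lam w t)) := by
  have := isProbabilityMeasure_cycleLaw hl hw ht
  have hm : Measurable fun y => (cycleLength y : ℝ) :=
    measurable_from_nat.comp measurable_cycleLength
  have hint : Integrable (fun y => (cycleLength y : ℝ)) (cycleLaw lam w t) := by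
    refine Integrable.of_bound hm.aestronglyMeasurable 3 (Eventually.of_forall fun y => ?_)
    rw [Real.norm_natCast]
    unfold cycleLength
    split_ifs <;> norm_num
  filter_upwards [tendsto_cycle_average hM hX hm knownAtEnd_cycleLength hint] with ω hω
  refine hω.congr fun n => ?_
  rw [(X ω).cycleStart_eq_sum n]
  push_cast
  rfl

include hM in
/-- The long-run quantities exist almost surely: a cycle consists of `meanLength` orders on
average and each of them takes the time `1 / lam`. -/
theorem ae_tendsto_longRun (hX : ∀ i, Measurable (times X i)) (hl : 0 < lam) (hw : 0 < w)
    (ht : 0 < t) (hA : ∀ᵐ ω ∂μ, (X ω).NoSimultaneousArrivals) (s : TakerState) :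
    ∀ᵐ ω ∂μ,
      Tendsto ((X ω).existenceFraction s) atTop
        (𝓝 (meanStay lam w t s / (1 / lam * meanLength lam w t))) ∧
      Tendsto ((X ω).entryRate s) atTop
        (𝓝 ((cycleLaw lam w t).real {y | 0 < stay s y} / (1 / lam * meanLength lam w t))) ∧
      Tendsto ((X ω).meanDwellTime s) atTop
        (𝓝 (meanStay lam w t s / (cycleLaw lam w t).real {y | 0 < stay s y})) := by
  have := isProbabilityMeasure_cycleLaw hl hw ht
  have hms := measurableSet_stay_pos s
  have hind : Measurable fun y => if 0 < stay s y then (1 : ℝ) else 0 :=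
    Measurable.ite hms measurable_const measurable_const
  have hint : Integrable (fun y => if 0 < stay s y then (1 : ℝ) else 0) (cycleLaw lam w t) :=
    (integrable_const (1 : ℝ)).indicator hms
  have hval : ∫ y, (if 0 < stay s y then (1 : ℝ) else 0) ∂(cycleLaw lam w t) =
      (cycleLaw lam w t).real {y | 0 < stay s y} := integral_indicator_one hms
  have h1 := tendsto_cycle_average hM hX (measurable_stay s) (knownAtEnd_stay s)
    (integrable_stay hl hw ht s)
  have h2 := tendsto_cycle_average hM hX hind
    (fun a f b p b' p' h => by simp only [knownAtEnd_stay s a f b p b' p' h]) hint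
  rw [integral_stay hl hw ht] at h1
  rw [hval] at h2
  filter_upwards [ae_regular hM hA, tendsto_arrival hM hl, tendsto_cycleStart hM hX hl hw ht, h1,
    h2] with ω hR harr hlen h1 h2
  exact Realization.tendsto_of_cycle_averages hR s (meanLength_pos hl hw ht) (by positivity)
    (visit_ne_zero hl hw ht s) hlen harr h1 h2

/-! ### Limits of averaged probabilities -/

theorem measurable_arrival (hX : ∀ i, Measurable (times X i)) (k : ℕ) :
    Measurable fun ω => (X ω).arrival k :=
  Finset.measurable_sum _ fun l _ => hX (.inl l)

/-- The pairs `(ω, r)` such that a taker in state `s` exists at time `r`, described through the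
cycles, form a measurable set. -/
theorem measurableSet_existence (hX : ∀ i, Measurable (times X i)) (s : TakerState) :
    MeasurableSet {z : Ω × ℝ | ∃ n, z.2 ∈ (X z.1).stayInterval s n} := by
  have h1 : {z : Ω × ℝ | ∃ n, z.2 ∈ (X z.1).stayInterval s n} =
      ⋃ n, ⋃ k, (Prod.fst ⁻¹' {ω | (X ω).cycleStart n = k}) ∩
        ({z : Ω × ℝ | (X z.1).arrival k + enterTime s ((X z.1).cycleData k) ≤ z.2} ∩
         {z : Ω × ℝ | z.2 < (X z.1).arrival k + leaveTime s ((X z.1).cycleData k)}) := by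
    ext z
    simp [Realization.stayInterval]
  have hd : ∀ k, Measurable fun ω => (X ω).cycleData k := fun k =>
    (measurable_cycleData (S := Set.univ) (Set.subset_univ _)).mono (sigmaOf_le hX _) le_rfl
  rw [h1]
  refine MeasurableSet.iUnion fun n => MeasurableSet.iUnion fun k =>
    (measurable_fst (measurableSet_cycleStart hX n k)).inter (MeasurableSet.inter ?_ ?_)
  · exact measurableSet_le (((measurable_arrival hX k).add
      ((measurable_enterTime s).comp (hd k))).comp measurable_fst) measurable_snd
  · exact measurableSet_lt measurable_snd (((measurable_arrival hX k).add
      ((measurable_leaveTime s).comp (hd k))).comp measurable_fst)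

/-- By Fubini, the mean fraction of `[0, u]` during which a taker exists is the average over `[0, u]`
of the probability that a taker exists. -/
theorem integral_existenceFraction (hX : ∀ i, Measurable (times X i))
    (hR : ∀ᵐ ω ∂μ, (X ω).Regular) (s : TakerState) {u : ℝ} (hu : 0 < u) :
    AEStronglyMeasurable (fun ω => (X ω).existenceFraction s u) μ ∧
    ∫ ω, (X ω).existenceFraction s u ∂μ =
      (∫ r in (0 : ℝ)..u, μ.real {ω | (X ω).TakerExists s r}) / u := by
  set B : Set (Ω × ℝ) := {z | ∃ n, z.2 ∈ (X z.1).stayInterval s n} with hB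
  have hBm : MeasurableSet B := measurableSet_existence hX s
  have hint : Integrable (fun z : Ω × ℝ => B.indicator (1 : Ω × ℝ → ℝ) z)
      (μ.prod (volume.restrict (Set.Icc 0 u))) := (integrable_const (1 : ℝ)).indicator hBm
  have h1 : ∀ᵐ ω ∂μ, (X ω).existenceFraction s u =
      (∫ r in Set.Icc 0 u, B.indicator (1 : Ω × ℝ → ℝ) (ω, r)) / u := by
    filter_upwards [hR] with ω hω
    have h2 : MeasurableSet (Prod.mk ω ⁻¹' B) := measurable_prodMk_left hBm
    have h3 : ∫ r in Set.Icc 0 u, B.indicator (1 : Ω × ℝ → ℝ) (ω, r) =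
        (volume.restrict (Set.Icc 0 u)).real (Prod.mk ω ⁻¹' B) := by
      rw [← integral_indicator_one h2]; rfl
    rw [h3, measureReal_restrict_apply h2, Realization.existenceFraction]
    congr 2
    ext r
    simp only [Set.mem_ofPred_eq, Set.mem_inter_iff, Set.mem_preimage, hB,
      Realization.takerExists_iff hω]
    exact and_comm
  have h4 : ∀ r, μ.real {ω | (X ω).TakerExists s r} =
      ∫ ω, B.indicator (1 : Ω × ℝ → ℝ) (ω, r) ∂μ := by
    intro r
    have h2 : MeasurableSet ((fun ω => (ω, r)) ⁻¹' B) := measurable_prodMk_right hBm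
    have h3 : ∫ ω, B.indicator (1 : Ω × ℝ → ℝ) (ω, r) ∂μ = μ.real ((fun ω => (ω, r)) ⁻¹' B) := by
      rw [← integral_indicator_one h2]; rfl
    rw [h3]
    refine measureReal_congr ?_
    filter_upwards [hR] with ω hω
    exact propext (Realization.takerExists_iff hω s r)
  refine ⟨(hint.integral_prod_left.div_const u).aestronglyMeasurable.congr (h1.mono fun _ h => h.symm),
    ?_⟩
  rw [integral_congr_ae h1, integral_div, integral_integral_swap hint,
    intervalIntegral.integral_of_le hu.le, ← integral_Icc_eq_integral_Ioc]
  simp only [h4]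

theorem existenceFraction_mem_Icc (R : Realization) (s : TakerState) {u : ℝ} (hu : 0 < u) :
    R.existenceFraction s u ∈ Set.Icc 0 1 := by
  refine ⟨by unfold Realization.existenceFraction; positivity, ?_⟩
  rw [Realization.existenceFraction, div_le_one hu]
  calc volume.real {r ∈ Set.Icc 0 u | R.TakerExists s r} ≤ volume.real (Set.Icc 0 u) :=
        measureReal_mono (fun r hr => hr.1) measure_Icc_lt_top.ne
    _ = u := by simp [hu.le]

/-- Almost sure convergence of the bounded fractions implies convergence of their means. -/
theorem tendsto_mean_existence (hX : ∀ i, Measurable (times X i))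
    (hR : ∀ᵐ ω ∂μ, (X ω).Regular) (s : TakerState) {ρ : ℝ}
    (h : ∀ᵐ ω ∂μ, Tendsto ((X ω).existenceFraction s) atTop (𝓝 ρ)) :
    Tendsto (fun u : ℝ => (∫ r in (0 : ℝ)..u, μ.real {ω | (X ω).TakerExists s r}) / u)
      atTop (𝓝 ρ) := by
  have h1 := tendsto_integral_filter_of_dominated_convergence (μ := μ) (l := atTop)
    (F := fun u ω => (X ω).existenceFraction s u) (f := fun _ => ρ) (fun _ => 1)
    ((eventually_gt_atTop 0).mono fun u hu => (integral_existenceFraction hX hR s hu).1)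
    ((eventually_gt_atTop 0).mono fun u hu => Eventually.of_forall fun ω => by
      have h2 := existenceFraction_mem_Icc (X ω) s hu
      rw [Real.norm_of_nonneg h2.1]
      exact h2.2)
    (integrable_const 1) h
  rw [integral_const, probReal_univ, one_smul] at h1
  refine h1.congr' ?_
  filter_upwards [eventually_gt_atTop 0] with u hu
  exact (integral_existenceFraction hX hR s hu).2

/-- The counterpart of `tendsto_mean_existence` for the fraction of matched seekers. -/
theorem tendsto_mean_matched (hX : ∀ i, Measurable (times X i))
    (hR : ∀ᵐ ω ∂μ, (X ω).Regular) {p : ℝ}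
    (h : ∀ᵐ ω ∂μ, Tendsto (X ω).matchedFraction atTop (𝓝 p)) :
    Tendsto (fun n : ℕ => (∑ k ∈ Finset.range n, μ.real {ω | (X ω).partner k ≠ none}) / n)
      atTop (𝓝 p) := by
  classical
  let D : ℕ → Set Ω := fun k => {ω | k ∈ Set.range (X ω).cycleStart}ᶜ
  have hD : ∀ k, MeasurableSet (D k) := fun k => by
    have h1 : {ω | k ∈ Set.range (X ω).cycleStart} = ⋃ n, {ω | (X ω).cycleStart n = k} := by
      ext ω; simp
    exact (h1 ▸ MeasurableSet.iUnion fun n => measurableSet_cycleStart hX n k).compl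
  have hint : ∀ k, Integrable ((D k).indicator (1 : Ω → ℝ)) μ := fun k =>
    (integrable_const (1 : ℝ)).indicator (hD k)
  have h1 : ∀ n, (fun ω => (X ω).matchedFraction n) =ᵐ[μ]
      fun ω => (∑ k ∈ Finset.range n, (D k).indicator (1 : Ω → ℝ) ω) / n := by
    intro n
    filter_upwards [hR] with ω hω
    have h2 : {k | k < n ∧ (X ω).partner k ≠ none} =
        ((Finset.range n).filter fun k => ω ∈ D k : Finset ℕ) := by
      ext k
      simp [D, Realization.partner_eq_none_iff hω.1 hω.2 hω.3]
    rw [Realization.matchedFraction, h2, Set.ncard_coe_finset, Finset.card_filter]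
    simp [Set.indicator]
  have h3 : ∀ n, ∫ ω, (X ω).matchedFraction n ∂μ =
      (∑ k ∈ Finset.range n, μ.real {ω | (X ω).partner k ≠ none}) / n := by
    intro n
    rw [integral_congr_ae (h1 n), integral_div, integral_finsetSum _ fun k _ => hint k]
    congr 1
    refine Finset.sum_congr rfl fun k _ => ?_
    rw [integral_indicator_one (hD k)]
    refine measureReal_congr ?_
    filter_upwards [hR] with ω hω
    exact propext (not_congr (Realization.partner_eq_none_iff hω.1 hω.2 hω.3 k).symm)
  have h4 := tendsto_integral_filter_of_dominated_convergence (μ := μ) (l := atTop)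
    (F := fun n ω => (X ω).matchedFraction n) (f := fun _ => p) (fun _ => 1)
    (Eventually.of_forall fun n =>
      ((integrable_finsetSum _ fun k _ => hint k).div_const (n : ℝ)).aestronglyMeasurable.congr
        (h1 n).symm)
    (Eventually.of_forall fun n => Eventually.of_forall fun ω => by
      have h5 : Set.ncard {k | k < n ∧ (X ω).partner k ≠ none} ≤ n := by
        have h6 := Set.ncard_le_ncard (s := {k | k < n ∧ (X ω).partner k ≠ none})
          (t := (Finset.range n : Set ℕ)) (fun k hk => by simpa using hk.1) (Finset.finite_toSet _)
        rwa [Set.ncard_coe_finset, Finset.card_range] at h6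
      rw [Realization.matchedFraction, Real.norm_of_nonneg (by positivity)]
      exact div_le_one_of_le₀ (by exact_mod_cast h5) (Nat.cast_nonneg n))
    (integrable_const 1) h
  rw [integral_const, probReal_univ, one_smul] at h4
  exact h4.congr h3

end

/-! ### The long-run averages of the model -/

theorem mainTheorem2 :
    -- At most one taker exists at any time, in particular at most one in each state.
    (∀ R : Realization, R.NoSimultaneousArrivals → R.TakersFirst →
      ∀ (u : ℝ) (c c' : ℕ) (s s' : TakerState),
        R.InState c u s → R.InState c' u s' → c = c' ∧ s = s') ∧
    -- Existence probabilities `rho`, entry rates `lamUm`, mean dwell times `tau`, and the matching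
    -- probability `ps` of a seeker.
    (∀ {Ω : Type*} [MeasurableSpace Ω] (μ : Measure Ω) [IsProbabilityMeasure μ]
      (lam w t : ℝ) (_ : 0 < lam) (_ : 0 < w) (_ : 0 < t)
      (X : Ω → Realization) (_ : IsMatchingModel μ lam w t X),
      (∀ᵐ ω ∂μ, (X ω).NoSimultaneousArrivals) →
      ∃ (rho lamUm tau : TakerState → ℝ) (ps : ℝ),
        (∀ s,
          (∀ᵐ ω ∂μ, Tendsto ((X ω).existenceFraction s) atTop (𝓝 (rho s))) ∧
          Tendsto (fun u : ℝ => (∫ r in (0 : ℝ)..u, μ.real {ω | (X ω).TakerExists s r}) / u)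
            atTop (𝓝 (rho s)) ∧
          (∀ᵐ ω ∂μ, Tendsto ((X ω).entryRate s) atTop (𝓝 (lamUm s))) ∧
          (∀ᵐ ω ∂μ, Tendsto ((X ω).meanDwellTime s) atTop (𝓝 (tau s))) ∧
          rho s = lamUm s * tau s) ∧
        (∀ᵐ ω ∂μ, Tendsto (X ω).matchedFraction atTop (𝓝 ps)) ∧
        Tendsto (fun n : ℕ => (∑ k ∈ Finset.range n, μ.real {ω | (X ω).partner k ≠ none}) / n)
          atTop (𝓝 ps) ∧
        ps = rho .one_one + rho .two_one + rho .two_two ∧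
        rho .one_one = lam * (1 - ps) * (w / (1 + lam * w)) ∧
        rho .two_one = lam * (1 - ps) * (lam * w / (1 + lam * w)) * (w / (1 + lam * w)) ∧
        rho .two_two =
          lam * (1 - ps) * (lam * w / (1 + lam * w) ^ 2) * (t / (1 + lam * t))) := by
  refine ⟨fun R hA hT u c c' s s' h h' => Realization.taker_unique hA hT h h', ?_⟩
  intro Ω _ μ _ lam w t hl hw ht X hM hA
  obtain ⟨X', heq, hM', hX'⟩ := exists_measurable_version hM
  have hA' : ∀ᵐ ω ∂μ, (X' ω).NoSimultaneousArrivals := by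
    filter_upwards [hA, heq] with ω h e
    exact e ▸ h
  have hR := ae_regular hM' hA'
  have hlong := ae_tendsto_longRun hM' hX' hl hw ht hA'
  have hlen := meanLength_pos hl hw ht
  have hmatch : ∀ᵐ ω ∂μ, Tendsto (X' ω).matchedFraction atTop (𝓝 (1 - 1 / meanLength lam w t)) := by
    filter_upwards [hR, tendsto_cycleStart hM' hX' hl hw ht] with ω hω h
    exact Realization.tendsto_matchedFraction hω hlen h
  have hrate : ∀ s, meanStay lam w t s / (1 / lam * meanLength lam w t) =
      lam * (1 - (1 - 1 / meanLength lam w t)) * meanStay lam w t s := fun s => by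
    field_simp; ring
  refine ⟨fun s => meanStay lam w t s / (1 / lam * meanLength lam w t),
    fun s => (cycleLaw lam w t).real {y | 0 < stay s y} / (1 / lam * meanLength lam w t),
    fun s => meanStay lam w t s / (cycleLaw lam w t).real {y | 0 < stay s y},
    1 - 1 / meanLength lam w t, fun s => ⟨?_, ?_, ?_, ?_, ?_⟩, ?_, ?_, ?_, ?_, ?_, ?_⟩
  · filter_upwards [hlong s, heq] with ω h e
    exact e ▸ h.1
  · refine (tendsto_mean_existence hX' hR s ((hlong s).mono fun ω h => h.1)).congr fun u => ?_
    congr 1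
    refine intervalIntegral.integral_congr fun r _ => measureReal_congr ?_
    filter_upwards [heq] with ω e
    exact congrArg (fun R : Realization => R.TakerExists s r) e.symm
  · filter_upwards [hlong s, heq] with ω h e
    exact e ▸ h.2.1
  · filter_upwards [hlong s, heq] with ω h e
    exact e ▸ h.2.2
  · have := visit_ne_zero hl hw ht s
    field_simp
  · filter_upwards [hmatch, heq] with ω h e
    exact e ▸ h
  · refine (tendsto_mean_matched hX' hR hmatch).congr fun n => ?_
    congr 1
    refine Finset.sum_congr rfl fun k _ => measureReal_congr ?_
    filter_upwards [heq] with ω e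
    exact congrArg (fun R : Realization => R.partner k ≠ none) e.symm
  · have h := meanLength_eq hl hw ht
    field_simp
    linarith
  · exact hrate .one_one
  · exact (hrate .two_one).trans (mul_assoc _ _ _).symm
  · exact (hrate .two_two).trans (mul_assoc _ _ _).symm
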